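/- Theorem (Sinkhorn W2GAN recovers PCA). Let $0\le r\le d$ be integers, let $\lambda>0$, let $K_Y\in\mathbb R^{d\times d}$ be symmetric positive semidefinite, and let $P_Y=\mathcal N(0,K_Y)$ and $X\sim\mathcal N(0,I_r)$. For $G\in\mathbb R^{d\times r}$ let $P_{GX}$ be the law of $GX$. For probability measures $\mu,\nu$ on $\mathbb R^d$ let $$W_{2,\lambda}^2(\mu,\nu)=\inf_{\pi}\ \mathbb E_\pi\|Z-Y\|^2+\lambda I_\pi(Z;Y),$$ the infimum being over all laws $\pi$ of pairs $(Z,Y)$ with marginals $\mu$ and $\nu$, where $I_\pi$ is the mutual information in nats, and let $$S_\lambda(\mu,\nu)=W_{2,\lambda}^2(\mu,\nu)-\tfrac12\bigl(W_{2,\lambda}^2(\mu,\mu)+W_{2,\lambda}^2(\nu,\nu)\bigr)$$ be the Sinkhorn divergence. Call a matrix $M$ an $r$-PCA of $K_Y$ if $M=\sum_{i=1}^r\lambda_i u_iu_i^{T}$ for some orthonormal basis $u_1,\dots,u_d$ of $\mathbb R^d$ consisting of eigenvectors of $K_Y$, with eigenvalues $\lambda_1\ge\dots\ge\lambda_d$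 (it is unique unless $0<r<d$ and $\lambda_r=\lambda_{r+1}>0$). Then $W_{2,\lambda}^2(P_Y,P_Y)$, $W_{2,\lambda}^2(P_{GX},P_Y)$ and $W_{2,\lambda}^2(P_{GX},P_{GX})$ are finite for every $G$, and the problem $$\min_{G\in\mathbb R^{d\times r}}S_\lambda(P_{GX},P_Y)$$ has a minimizer. A matrix $G$ is a minimizer if and only if the covariance matrix of $P_{GX}$ is an $r$-PCA of $K_Y$, and every $r$-PCA of $K_Y$ is the covariance matrix of $P_{GX}$ for some $G$. Moreover, for every minimizer $G$ one has $S_\lambda(P_{GX},P_Y)\ne 0$ if and only if $\operatorname{rank}K_Y>r$. -/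

import Mathlib

open MeasureTheory ProbabilityTheory InformationTheory
open scoped ENNReal NNReal Matrix

noncomputable section

namespace SinkhornPCA

/-- The measures on `E × F` with marginals
`μ` and `ν`. -/
def couplings {E F : Type*} [MeasurableSpace E] [MeasurableSpace F]
    (μ : Measure E) (ν : Measure F) : Set (Measure (E × F)) :=
  {π | π.fst = μ ∧ π.snd = ν}

/-- The mutual information (in nats) of a joint law: the Kullback-Leibler divergence from the
joint law to the product of its marginals. -/
def mutualInfo {E F : Type*} [MeasurableSpace E] [MeasurableSpace F]
    (π : Measure (E × F)) : ℝ≥0∞ :=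
  klDiv π (π.fst.prod π.snd)

/-- The entropy-regularized squared 2-Wasserstein distance
`inf_π E_π ‖Z - Y‖² + lam * I_π(Z; Y)`, with values in `[0, ∞]`. -/
def entropicW2sq {E : Type*} [NormedAddCommGroup E] [MeasurableSpace E]
    (lam : ℝ≥0) (μ ν : Measure E) : ℝ≥0∞ :=
  ⨅ π ∈ couplings μ ν, (∫⁻ p, ‖p.1 - p.2‖ₑ ^ 2 ∂π) + (lam : ℝ≥0∞) * mutualInfo π

/-- The Sinkhorn divergence. It is meaningful when the three regularized distances in it are
finite. -/
def sinkhornDiv {E : Type*} [NormedAddCommGroup E] [MeasurableSpace E]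
    (lam : ℝ≥0) (μ ν : Measure E) : ℝ :=
  (entropicW2sq lam μ ν).toReal
    - ((entropicW2sq lam μ μ).toReal + (entropicW2sq lam ν ν).toReal) / 2

/-- The law of `G X`, where `X` is a standard Gaussian vector in `ℝ^r`. -/
def generatedLaw {d r : ℕ} (G : Matrix (Fin d) (Fin r) ℝ) : Measure (EuclideanSpace ℝ (Fin d)) :=
  (multivariateGaussian (0 : EuclideanSpace ℝ (Fin r)) (1 : Matrix (Fin r) (Fin r) ℝ)).map
    (Matrix.toEuclideanLin G)

/-- The covariance matrix of a law on `ℝ^d`. -/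
def covarianceMatrix {d : ℕ} (μ : Measure (EuclideanSpace ℝ (Fin d))) :
    Matrix (Fin d) (Fin d) ℝ :=
  Matrix.of fun i j => cov[fun x => x i, fun x => x j; μ]

/-- `M` is an `r`-PCA truncation of the symmetric matrix `K`: for some orthonormal basis of
eigenvectors `u i` of `K`, listed with the eigenvalues `ev i` in nonincreasing order,
`M = ∑_{i < r} ev i • u i (u i)ᵀ`. -/
def IsPCA {d : ℕ} (r : ℕ) (K M : Matrix (Fin d) (Fin d) ℝ) : Prop :=
  ∃ (u : OrthonormalBasis (Fin d) ℝ (EuclideanSpace ℝ (Fin d))) (ev : Fin d → ℝ),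
    Antitone ev ∧
    (∀ i, Matrix.toEuclideanLin K (u i) = ev i • u i) ∧
    M = ∑ i ∈ Finset.univ.filter (fun i : Fin d => (i : ℕ) < r),
      ev i • Matrix.vecMulVec (u i).ofLp (u i).ofLp

end SinkhornPCA

end

/-!
For centered Gaussians with covariances `A`, `B` the regularized distance is governed by the scalar
function `gain lam a = max_ρ (2 a ρ + (lam / 2) log (1 - ρ²))`: it measures what an entropic
coupling of two Gaussians of variance `a` saves over the independent coupling. Its derivative
`2 * corr lam a` is strictly increasing, so that `gain` is strictly convex and strictly increasing
(`gain_tangent_lt`), with `gain lam 0 = 0`.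

*Upper bound* (`entropicW2sq_le`). If `A` and `B` agree on a family that carries the interaction of
the two measures, the Gaussian coupling with correlations `corr lam (a i)` is admissible. Its
log-density with respect to the product measure is a cross term, which cancels the one in the
quadratic cost, plus functions of one variable. This gives `E‖Z‖² + E‖Y‖² - ∑ gain lam (a i)`.

*Lower bound* (`le_entropicW2sq`). For an arbitrary coupling the Donsker-Varadhan inequality is
applied to the log-density of a Gaussian regression of `Y` on `Z` with prescribed residual variances
(`sum_regression_le_mutualInfo`), and to the one of `Z` on `Y`. The average of the two bounds,
maximized over the cross-covariance (`two_mul_cross_le`), is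
`E‖Z‖² + E‖Y‖² - (∑ gain lam (a i) + ∑ gain lam (b k)) / 2` plus an explicit nonnegative
defect. Here `a` and `b` may be the eigenvalues of the compressions of `A` and `B` to any subspace
`V` that contains the range of `A`, since `Z` is in `V` almost surely; the defect vanishes only if
the two compressions agree.

The self-distances are exact, so the divergence from a Gaussian of rank at most `r` is at least
`(∑ j, gain lam (e j) - ∑ k, gain lam (b k)) / 2`, with `e` the eigenvalues of `B` and `b` those of
its compression to some `V` of dimension `r` (`le_sinkhornDiv`). By Jensen's inequality and Ky Fan's
principle (`sum_gain_le`) this is at least half the total gain of the `d - r` smallest eigenvalues,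
a value that the truncated spectral decompositions reach (`sinkhornDiv_le`). In the case of equality
the defect vanishes, `V` is spanned by eigenvectors of `B` (strict convexity of `gain`), and these
belong to the largest eigenvalues (`eigenvalue_le_of_sum_gain_le`): this is
`exists_eigenbasis_of_sinkhornDiv_le`. The optimal value is zero exactly when the discarded
eigenvalues are.
-/

namespace SinkhornPCA

open scoped RealInnerProductSpace

/-! ### The scalar optimization problem -/

/-- The correlation `ρ ∈ [0, 1)` with `2 a (1 - ρ²) = lam ρ`, that is, the maximizer of
`ρ ↦ 2 a ρ + (lam / 2) log (1 - ρ²)`. The root of the quadratic equation is written in the form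
which makes sense for `a = 0`. -/
noncomputable def corr (lam a : ℝ) : ℝ := 4 * a / (lam + √(lam ^ 2 + 16 * a ^ 2))

/-- The value `max_ρ 2 a ρ + (lam / 2) log (1 - ρ²)`: the gain that the optimal entropic coupling
of two centered Gaussians of variance `a` has over the independent coupling. -/
noncomputable def gain (lam a : ℝ) : ℝ :=
  2 * a * corr lam a + lam / 2 * Real.log (1 - corr lam a ^ 2)

section scalar

variable {lam a b : ℝ}

lemma corr_nonneg (hl : 0 < lam) (ha : 0 ≤ a) : 0 ≤ corr lam a := by
  unfold corr; positivity

lemma corr_zero : corr lam 0 = 0 := by simp [corr]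

lemma corr_eq (hl : 0 < lam) (a : ℝ) : 2 * a * (1 - corr lam a ^ 2) = lam * corr lam a := by
  unfold corr
  have hs : √(lam ^ 2 + 16 * a ^ 2) ^ 2 = lam ^ 2 + 16 * a ^ 2 := Real.sq_sqrt (by positivity)
  have hpos : 0 < lam + √(lam ^ 2 + 16 * a ^ 2) := by positivity
  generalize √(lam ^ 2 + 16 * a ^ 2) = s at hs hpos
  field_simp
  linear_combination a * 2 * hs

lemma corr_lt_one (hl : 0 < lam) (ha : 0 ≤ a) : corr lam a < 1 := by
  have h := corr_eq hl a
  have h0 := corr_nonneg hl ha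
  by_contra! hc
  nlinarith [mul_nonneg ha (by nlinarith : 0 ≤ corr lam a ^ 2 - 1)]

lemma one_sub_corr_sq_pos (hl : 0 < lam) (ha : 0 ≤ a) : 0 < 1 - corr lam a ^ 2 := by
  nlinarith [corr_lt_one hl ha, corr_nonneg hl ha]

lemma corr_pos (hl : 0 < lam) (ha : 0 < a) : 0 < corr lam a := by
  unfold corr; positivity

lemma corr_injOn (hl : 0 < lam) (ha : 0 ≤ a) (h : corr lam a = corr lam b) :
    a = b := by
  have h1 := corr_eq hl a
  have h2 := corr_eq hl b
  rw [← h] at h2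
  have := one_sub_corr_sq_pos hl ha
  have : (a - b) * (1 - corr lam a ^ 2) = 0 := by linarith
  rcases mul_eq_zero.1 this with h | h <;> linarith

/-- The products `a * corr lam a` determine `a`: this identifies the covariances when the defect in
the lower bound vanishes. -/
lemma mul_corr_injOn (hl : 0 < lam) (ha : 0 ≤ a) (hb : 0 ≤ b)
    (h : a * corr lam a = b * corr lam b) : a = b := by
  apply corr_injOn hl ha
  have h1 := corr_eq hl a
  have h2 := corr_eq hl b
  have ha' := corr_nonneg hl ha
  have hb' := corr_nonneg hl hb
  -- `ρ²` is a function of `p = a ρ`, namely `2 p / (lam + 2 p)`.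
  have e : (lam + 2 * (a * corr lam a)) * (corr lam a ^ 2 - corr lam b ^ 2) = 0 := by
    linear_combination (-corr lam a) * h1 + corr lam b * h2 + 2 * h - 2 * corr lam b ^ 2 * h
  have hp : 0 < lam + 2 * (a * corr lam a) := by positivity
  have := (mul_eq_zero.1 e).resolve_left hp.ne'
  exact (sq_eq_sq₀ ha' hb').1 (by linarith)

lemma gain_zero : gain lam 0 = 0 := by simp [gain, corr_zero]

/-- The graph of `gain` lies strictly above its tangents. -/
lemma gain_tangent_lt (hl : 0 < lam) (ha : 0 ≤ a) (hb : 0 ≤ b) (hab : a ≠ b) :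
    gain lam b + 2 * corr lam b * (a - b) < gain lam a := by
  have hne : corr lam b ≠ corr lam a := fun h ↦ hab (corr_injOn hl hb h).symm
  have h1 := corr_eq hl a
  have ha' := corr_nonneg hl ha
  have hb' := corr_nonneg hl hb
  have sa := one_sub_corr_sq_pos hl ha
  have sb := one_sub_corr_sq_pos hl hb
  unfold gain
  generalize corr lam a = x at *
  generalize corr lam b = y at *
  have hr : (1 - y ^ 2) / (1 - x ^ 2) ≠ 1 := by
    rw [ne_eq, div_eq_one_iff_eq sa.ne']
    intro h
    exact hne ((sq_eq_sq₀ hb' ha').1 (by linarith))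
  have hlog := Real.log_lt_sub_one_of_pos (div_pos sb sa) hr
  rw [Real.log_div sb.ne' sa.ne'] at hlog
  have h2 : lam / 2 * ((1 - y ^ 2) / (1 - x ^ 2) - 1) ≤ 2 * a * (x - y) := by
    rw [div_sub_one sa.ne', mul_div_assoc', div_le_iff₀ sa]
    have : 2 * a * (x - y) * (1 - x ^ 2) = lam * x * (x - y) := by rw [← h1]; ring
    rw [this]
    nlinarith [mul_nonneg hl.le (sq_nonneg (x - y))]
  have := mul_lt_mul_of_pos_left hlog (half_pos hl)
  linarith

lemma gain_tangent_le (hl : 0 < lam) (ha : 0 ≤ a) (hb : 0 ≤ b) :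
    gain lam b + 2 * corr lam b * (a - b) ≤ gain lam a := by
  rcases eq_or_ne a b with rfl | h
  · simp
  · exact (gain_tangent_lt hl ha hb h).le

lemma gain_lt_gain (hl : 0 < lam) (ha : 0 ≤ a) (hab : a < b) : gain lam a < gain lam b := by
  have h := gain_tangent_lt hl (ha.trans hab.le) ha hab.ne'
  have := mul_nonneg (corr_nonneg hl ha) (sub_pos.2 hab).le
  linarith

lemma gain_le_gain (hl : 0 < lam) (ha : 0 ≤ a) (hab : a ≤ b) : gain lam a ≤ gain lam b := by
  rcases hab.eq_or_lt with rfl | h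
  · rfl
  · exact (gain_lt_gain hl ha h).le

lemma gain_nonneg (hl : 0 < lam) (ha : 0 ≤ a) : 0 ≤ gain lam a := by
  simpa [gain_zero] using gain_le_gain hl le_rfl ha

lemma gain_eq_zero_iff (hl : 0 < lam) (ha : 0 ≤ a) : gain lam a = 0 ↔ a = 0 := by
  refine ⟨fun h ↦ ?_, fun h ↦ by rw [h, gain_zero]⟩
  rcases ha.eq_or_lt with h' | h'
  · exact h'.symm
  · have := gain_lt_gain hl le_rfl h'
    rw [gain_zero] at this
    linarith

end scalar

/-! ### Relative entropy and exponential densities -/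

section entropy

variable {α : Type*} [MeasurableSpace α] {π ρ : Measure α} {f : α → ℝ}

/-- Donsker-Varadhan inequality for a test function with normalized exponential. -/
lemma integral_le_toReal_klDiv [IsProbabilityMeasure π] [IsProbabilityMeasure ρ]
    (h : klDiv π ρ ≠ ∞) (hfm : Measurable f) (hf : Integrable f π)
    (hexp : ∫⁻ x, ENNReal.ofReal (Real.exp (f x)) ∂ρ = 1) :
    ∫ x, f x ∂π ≤ (klDiv π ρ).toReal := by
  obtain ⟨hac, hint⟩ := klDiv_ne_top_iff.1 h
  have hi : Integrable (fun x ↦ Real.exp (f x)) ρ := by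
    refine ⟨by fun_prop, ?_⟩
    rw [hasFiniteIntegral_iff_ofReal (.of_forall fun x ↦ (Real.exp_pos _).le), hexp]
    exact ENNReal.one_lt_top
  have h1 : ∫ x, Real.exp (f x) ∂ρ = 1 := by
    rw [integral_eq_lintegral_of_nonneg_ae (.of_forall fun x ↦ (Real.exp_pos _).le) (by fun_prop),
      hexp, ENNReal.toReal_one]
  have := isProbabilityMeasure_tilted hi
  have hac' : π ≪ ρ.tilted f := hac.trans (absolutelyContinuous_tilted hi)
  have h2 := integral_llr_tilted_right hac hf hi hint
  have h3 := integral_llr_add_sub_measure_univ_nonneg hac'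
    (integrable_llr_tilted_right hac hf hint hi)
  rw [toReal_klDiv_of_measure_eq hac (by simp)]
  simp only [probReal_univ, h1, Real.log_one] at h2 h3
  linarith

lemma klDiv_withDensity_exp [IsProbabilityMeasure ρ] (hfm : Measurable f)
    [IsProbabilityMeasure (ρ.withDensity fun x ↦ ENNReal.ofReal (Real.exp (f x)))]
    (hf : Integrable f (ρ.withDensity fun x ↦ ENNReal.ofReal (Real.exp (f x)))) :
    klDiv (ρ.withDensity fun x ↦ ENNReal.ofReal (Real.exp (f x))) ρ ≠ ∞ ∧
      (klDiv (ρ.withDensity fun x ↦ ENNReal.ofReal (Real.exp (f x))) ρ).toReal =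
        ∫ x, f x ∂(ρ.withDensity fun x ↦ ENNReal.ofReal (Real.exp (f x))) := by
  set π := ρ.withDensity fun x ↦ ENNReal.ofReal (Real.exp (f x)) with hπ
  have hac : π ≪ ρ := withDensity_absolutelyContinuous _ _
  have hllr : llr π ρ =ᵐ[π] f := by
    refine hac.ae_le ?_
    filter_upwards [Measure.rnDeriv_withDensity ρ
      (f := fun x ↦ ENNReal.ofReal (Real.exp (f x))) (by fun_prop)] with x hx
    rw [llr, hx, ENNReal.toReal_ofReal (Real.exp_pos _).le, Real.log_exp]
  exact ⟨klDiv_ne_top hac ((integrable_congr hllr).2 hf),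
    (toReal_klDiv_of_measure_eq hac (by simp)).trans (integral_congr_ae hllr)⟩

end entropy

/-- The density of `N(m, b s)` with respect to `N(0, b)` has total mass one. -/
lemma lintegral_exp_gaussianReal {b s : ℝ} (hb : 0 < b) (hs : 0 < s) (m : ℝ) :
    ∫⁻ y, ENNReal.ofReal (Real.exp (-(y - m) ^ 2 / (2 * (b * s)) + y ^ 2 / (2 * b)
      - Real.log s / 2)) ∂(gaussianReal 0 b.toNNReal) = 1 := by
  have hb' : b.toNNReal ≠ 0 := by simpa using hb
  have hbs : (b * s).toNNReal ≠ 0 := by simpa using mul_pos hb hs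
  rw [gaussianReal_of_var_ne_zero _ hb',
    lintegral_withDensity_eq_lintegral_mul _ (measurable_gaussianPDF _ _) (by fun_prop),
    ← lintegral_gaussianPDF_eq_one m hbs]
  refine lintegral_congr fun y ↦ ?_
  simp only [Pi.mul_apply, gaussianPDF, gaussianPDFReal]
  rw [← ENNReal.ofReal_mul (by positivity)]
  congr 1
  have hsq : (√(2 * Real.pi * (b * s)))⁻¹ =
      (√(2 * Real.pi * b))⁻¹ * Real.exp (-(Real.log s / 2)) := by
    rw [show 2 * Real.pi * (b * s) = (2 * Real.pi * b) * s by ring,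
      Real.sqrt_mul (by positivity) s, mul_inv, Real.exp_neg, Real.exp_half, Real.exp_log hs]
  rw [Real.coe_toNNReal _ hb.le, Real.coe_toNNReal _ (mul_pos hb hs).le, hsq,
    mul_assoc (√_)⁻¹, mul_assoc (√_)⁻¹,
    ← Real.exp_add, ← Real.exp_add]
  congr 2
  ring

/-! ### Couplings -/

section couplings

variable {E F : Type*} [MeasurableSpace E] [MeasurableSpace F] {μ : Measure E} {ν : Measure F}

lemma measurePreserving_fst_of_mem_couplings {π : Measure (E × F)} (hπ : π ∈ couplings μ ν) :
    MeasurePreserving Prod.fst π μ := ⟨measurable_fst, hπ.1⟩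

lemma measurePreserving_snd_of_mem_couplings {π : Measure (E × F)} (hπ : π ∈ couplings μ ν) :
    MeasurePreserving Prod.snd π ν := ⟨measurable_snd, hπ.2⟩

lemma isProbabilityMeasure_of_mem_couplings [IsProbabilityMeasure μ] {π : Measure (E × F)}
    (hπ : π ∈ couplings μ ν) : IsProbabilityMeasure π := by
  refine ⟨?_⟩
  rw [← Measure.fst_univ, hπ.1, measure_univ]

lemma mutualInfo_map_swap_le {π : Measure (E × F)} [IsFiniteMeasure π] :
    mutualInfo (π.map Prod.swap) ≤ mutualInfo π := by
  have h := klDiv_map_le π (π.fst.prod π.snd) measurable_swap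
  rw [Measure.prod_swap] at h
  simpa [mutualInfo, Measure.fst_map_swap, Measure.snd_map_swap] using h

lemma map_swap_mem_couplings {π : Measure (E × F)} (hπ : π ∈ couplings μ ν) :
    π.map Prod.swap ∈ couplings ν μ := by
  simpa [couplings, Measure.fst_map_swap, Measure.snd_map_swap] using hπ.symm

lemma fst_withDensity_prod [IsProbabilityMeasure ν] [SFinite μ] {g : E × F → ℝ≥0∞}
    (hg : Measurable g) (h : ∀ x, ∫⁻ y, g (x, y) ∂ν = 1) :
    ((μ.prod ν).withDensity g).fst = μ := by
  ext s hs
  rw [Measure.fst_apply hs, withDensity_apply _ (measurable_fst hs), ← Set.prod_univ,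
    ← Measure.prod_restrict, Measure.restrict_univ, lintegral_prod _ hg.aemeasurable]
  simp [h]

lemma snd_withDensity_prod [IsProbabilityMeasure μ] [SFinite ν] {g : E × F → ℝ≥0∞}
    (hg : Measurable g) (h : ∀ y, ∫⁻ x, g (x, y) ∂μ = 1) :
    ((μ.prod ν).withDensity g).snd = ν := by
  ext s hs
  rw [Measure.snd_apply hs, withDensity_apply _ (measurable_snd hs), ← Set.univ_prod,
    ← Measure.prod_restrict, Measure.restrict_univ, lintegral_prod_symm _ hg.aemeasurable]
  simp [h]

lemma lintegral_enorm_sq_eq {Ω G : Type*} [NormedAddCommGroup G] [MeasurableSpace Ω]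
    {P : Measure Ω} [IsFiniteMeasure P] {f : Ω → G} (hf : MemLp f 2 P) :
    ∫⁻ p, ‖f p‖ₑ ^ 2 ∂P = ENNReal.ofReal (∫ p, ‖f p‖ ^ 2 ∂P) := by
  rw [ofReal_integral_eq_lintegral_ofReal hf.integrable_norm_pow'
    (.of_forall fun _ ↦ by positivity)]
  refine lintegral_congr fun p ↦ ?_
  rw [ENNReal.ofReal_pow (norm_nonneg _), ofReal_norm]

end couplings

/-! ### Centered Gaussian measures -/

section gaussian

variable {E : Type*} [NormedAddCommGroup E] [InnerProductSpace ℝ E]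

/-- The compression of the operator `T` to the family `v` is the diagonal matrix `diag a`. The
family is not required to consist of eigenvectors of `T`. -/
def IsDiagOn {ι : Type*} (T : E →ₗ[ℝ] E) (v : ι → E) (a : ι → ℝ) : Prop :=
  (∀ i, ⟪v i, T (v i)⟫ = a i) ∧ Pairwise fun i k ↦ ⟪v i, T (v k)⟫ = 0

variable [MeasurableSpace E]

/-- `μ` is the centered Gaussian measure with covariance operator `T`. -/
structure IsCenteredGaussian (μ : Measure E) (T : E →ₗ[ℝ] E) : Prop where
  gaussian : IsGaussian μ
  mean : ∀ x, ∫ z, ⟪x, z⟫ ∂μ = 0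
  cov : ∀ x y, ∫ z, ⟪x, z⟫ * ⟪y, z⟫ ∂μ = ⟪x, T y⟫

variable {μ ν : Measure E} {A B : E →ₗ[ℝ] E} {ι κ : Type*} [Fintype ι] [Fintype κ]
  {v : ι → E} {w : κ → E} {a : ι → ℝ} {b : κ → ℝ}

namespace IsCenteredGaussian

lemma isProbabilityMeasure (hμ : IsCenteredGaussian μ A) : IsProbabilityMeasure μ :=
  have := hμ.gaussian
  inferInstance

lemma inner_nonneg (hμ : IsCenteredGaussian μ A) (x : E) : 0 ≤ ⟪x, A x⟫ := by
  rw [← hμ.cov]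
  exact integral_nonneg fun z ↦ mul_self_nonneg _

lemma isSymmetric (hμ : IsCenteredGaussian μ A) : A.IsSymmetric := fun x y ↦ by
  rw [real_inner_comm, ← hμ.cov, ← hμ.cov]
  simp_rw [mul_comm]

variable [FiniteDimensional ℝ E] [BorelSpace E]

lemma memLp_id (hμ : IsCenteredGaussian μ A) : MemLp (fun z : E ↦ z) 2 μ :=
  have := hμ.gaussian
  IsGaussian.memLp_two_id

lemma memLp_inner (hμ : IsCenteredGaussian μ A) (x : E) : MemLp (fun z ↦ ⟪x, z⟫) 2 μ :=
  hμ.memLp_id.const_inner x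

lemma ae_inner_eq_zero (hμ : IsCenteredGaussian μ A) {x : E} (hx : ⟪x, A x⟫ = 0) :
    ∀ᵐ z ∂μ, ⟪x, z⟫ = 0 := by
  rw [← hμ.cov, integral_eq_zero_iff_of_nonneg (fun z ↦ mul_self_nonneg _)
    ((hμ.memLp_inner x).integrable_mul (hμ.memLp_inner x))] at hx
  filter_upwards [hx] with z hz
  simpa using hz

lemma map_inner (hμ : IsCenteredGaussian μ A) (x : E) :
    μ.map (fun z ↦ ⟪x, z⟫) = gaussianReal 0 ⟪x, A x⟫.toNNReal := by
  have := hμ.gaussian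
  have h := IsGaussian.map_eq_gaussianReal (μ := μ) (innerSL ℝ x)
  have hv := variance_eq_sub (hμ.memLp_inner x)
  simp only [innerSL_apply_apply] at h
  rw [hμ.mean] at h hv
  have h2 : ∫ z, ((fun z ↦ ⟪x, z⟫) ^ 2) z ∂μ = ⟪x, A x⟫ := by
    rw [← hμ.cov]
    exact integral_congr_ae (.of_forall fun z ↦ by simp [sq])
  rw [h2] at hv
  have he : (innerSL ℝ x : E → ℝ) = fun z ↦ ⟪x, z⟫ := by ext; simp
  rw [he, hv] at h
  simpa using h

lemma iIndepFun_inner (hμ : IsCenteredGaussian μ A) (hv : IsDiagOn A v a) :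
    iIndepFun (fun i z ↦ ⟪v i, z⟫) μ := by
  have := hμ.gaussian
  have hlaw : HasGaussianLaw (fun (z : E) (i : ι) ↦ ⟪v i, z⟫) μ := by
    refine ⟨?_⟩
    have : (fun (z : E) (i : ι) ↦ ⟪v i, z⟫) =
        (ContinuousLinearMap.pi fun i ↦ innerSL ℝ (v i) : E →L[ℝ] ι → ℝ) := by
      ext; simp
    rw [this]
    infer_instance
  refine hlaw.iIndepFun_of_covariance_eq_zero fun i k hik ↦ ?_
  rw [covariance_eq_sub (hμ.memLp_inner _) (hμ.memLp_inner _), hμ.mean, zero_mul, sub_zero]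
  exact (hμ.cov _ _).trans (hv.2 hik)

/-- By independence, a function whose exponential is normalized coordinatewise has normalized
exponential. -/
lemma lintegral_exp_sum (hμ : IsCenteredGaussian μ A) (hv : IsDiagOn A v a) {φ : ι → ℝ → ℝ}
    (hφm : ∀ i, Measurable (φ i))
    (hφ : ∀ i, ∫⁻ t, ENNReal.ofReal (Real.exp (φ i t)) ∂(gaussianReal 0 (a i).toNNReal) = 1) :
    ∫⁻ z, ENNReal.ofReal (Real.exp (∑ i, φ i ⟪v i, z⟫)) ∂μ = 1 := by
  have hg : ∀ i, Measurable fun t ↦ ENNReal.ofReal (Real.exp (φ i t)) := fun i ↦ by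
    have := hφm i
    fun_prop
  have hi := (hμ.iIndepFun_inner hv).comp (fun i t ↦ ENNReal.ofReal (Real.exp (φ i t))) hg
  have h := lintegral_prod_eq_prod_lintegral_of_indepFun Finset.univ _ hi
    (fun i ↦ (hg i).comp (by fun_prop))
  simp only [Function.comp_apply] at h
  simp_rw [Real.exp_sum, ENNReal.ofReal_prod_of_nonneg fun i _ ↦ (Real.exp_pos _).le]
  rw [h]
  refine Finset.prod_eq_one fun i _ ↦ ?_
  rw [← hφ i, ← hv.1 i, ← hμ.map_inner, lintegral_map (hg i) (by fun_prop)]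

end IsCenteredGaussian

/-! ### Second moments -/

/-- The residual variance in a linear regression on uncorrelated variables. Regressors of
variance zero get coefficient zero by the convention for division by zero. -/
lemma integral_sub_regression_sq {Ω : Type*} [MeasurableSpace Ω] {P : Measure Ω}
    {Y : Ω → ℝ} {Z : ι → Ω → ℝ} {c : ι → ℝ} {b : ℝ} (hY : MemLp Y 2 P)
    (hZ : ∀ i, MemLp (Z i) 2 P) (hYY : ∫ p, Y p * Y p ∂P = b)
    (hZZ : ∀ i, ∫ p, Z i p * Z i p ∂P = a i)
    (hZZ' : Pairwise fun i k ↦ ∫ p, Z i p * Z k p ∂P = 0) (hZY : ∀ i, ∫ p, Z i p * Y p ∂P = c i) :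
    ∫ p, (Y p - ∑ i, c i / a i * Z i p) ^ 2 ∂P = b - ∑ i, c i ^ 2 / a i := by
  classical
  have hexp : ∀ p, (Y p - ∑ i, c i / a i * Z i p) ^ 2 = Y p * Y p
      - 2 * ∑ i, c i / a i * (Z i p * Y p)
      + ∑ i, ∑ k, (c i / a i) * (c k / a k) * (Z i p * Z k p) := by
    intro p
    have h1 : ∑ i, c i / a i * (Z i p * Y p) = (∑ i, c i / a i * Z i p) * Y p := by
      rw [Finset.sum_mul]
      exact Finset.sum_congr rfl fun i _ ↦ by ring
    have h2 : ∑ i, ∑ k, (c i / a i) * (c k / a k) * (Z i p * Z k p)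
        = (∑ i, c i / a i * Z i p) * (∑ i, c i / a i * Z i p) := by
      rw [Finset.sum_mul_sum]
      exact Finset.sum_congr rfl fun i _ ↦ Finset.sum_congr rfl fun k _ ↦ by ring
    rw [h1, h2]
    ring
  have iYY : Integrable (fun p ↦ Y p * Y p) P := hY.integrable_mul hY
  have iZY : ∀ i, Integrable (fun p ↦ c i / a i * (Z i p * Y p)) P := fun i ↦
    ((hZ i).integrable_mul hY).const_mul _
  have iZZ : ∀ i k, Integrable (fun p ↦ (c i / a i) * (c k / a k) * (Z i p * Z k p)) P := fun i k ↦
    ((hZ i).integrable_mul (hZ k)).const_mul _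
  have iZY' : Integrable (fun p ↦ 2 * ∑ i, c i / a i * (Z i p * Y p)) P :=
    (integrable_finsetSum _ fun i _ ↦ iZY i).const_mul 2
  have iZZ' : Integrable (fun p ↦ ∑ i, ∑ k, (c i / a i) * (c k / a k) * (Z i p * Z k p)) P :=
    integrable_finsetSum _ fun i _ ↦ integrable_finsetSum _ fun k _ ↦ iZZ i k
  have iYZ : Integrable (fun p ↦ Y p * Y p - 2 * ∑ i, c i / a i * (Z i p * Y p)) P :=
    iYY.sub iZY'
  simp_rw [hexp]
  rw [integral_add iYZ iZZ', integral_sub iYY iZY', integral_const_mul,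
    integral_finsetSum _ fun i _ ↦ iZY i,
    integral_finsetSum _ fun i _ ↦ integrable_finsetSum _ fun k _ ↦ iZZ i k, hYY, sub_add,
    Finset.mul_sum, ← Finset.sum_sub_distrib]
  congr 1
  refine Finset.sum_congr rfl fun i _ ↦ ?_
  rw [integral_finsetSum _ fun k _ ↦ iZZ i k, Finset.sum_eq_single i, integral_const_mul,
    integral_const_mul, hZY, hZZ]
  · rcases eq_or_ne (a i) 0 with h | h
    · simp [h]
    · field_simp
      ring
  · intro k _ hk
    rw [integral_const_mul, hZZ' hk.symm, mul_zero]
  · simp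

variable [FiniteDimensional ℝ E] [BorelSpace E]

/-! ### Lower bound for the entropic transport cost -/

/-- The information carried by a coupling is at least the expected log-likelihood ratio, against the
product measure, of the model in which the `⟪w k, y⟫` are, given `z`, independent Gaussians with
mean the linear regression on the `⟪v i, z⟫` and variances `b k * s k`. The `s k` are free parameters,
except that coordinates of variance zero do not contribute. -/
lemma sum_regression_le_mutualInfo (hμ : IsCenteredGaussian μ A) (hν : IsCenteredGaussian ν B)
    (hv : IsDiagOn A v a) (hw : IsDiagOn B w b) {s : κ → ℝ} (hs : ∀ k, 0 < s k)
    (hs0 : ∀ k, b k = 0 → s k = 1) {π : Measure (E × E)} (hπ : π ∈ couplings μ ν)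
    (hI : mutualInfo π ≠ ∞) :
    ∑ k, (-(b k - ∑ i, (∫ p, ⟪v i, p.1⟫ * ⟪w k, p.2⟫ ∂π) ^ 2 / a i) / (2 * (b k * s k))
      + b k / (2 * b k) - Real.log (s k) / 2) ≤ (mutualInfo π).toReal := by
  have := hμ.isProbabilityMeasure
  have := hν.isProbabilityMeasure
  have := isProbabilityMeasure_of_mem_couplings hπ
  have hfst := measurePreserving_fst_of_mem_couplings hπ
  have hsnd := measurePreserving_snd_of_mem_couplings hπ
  have hZ : ∀ i, MemLp (fun p : E × E ↦ ⟪v i, p.1⟫) 2 π := fun i ↦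
    (hμ.memLp_inner (v i)).comp_measurePreserving hfst
  have hY : ∀ k, MemLp (fun p : E × E ↦ ⟪w k, p.2⟫) 2 π := fun k ↦
    (hν.memLp_inner (w k)).comp_measurePreserving hsnd
  have hZZ : ∀ x y, ∫ p, ⟪x, p.1⟫ * ⟪y, p.1⟫ ∂π = ⟪x, A y⟫ := fun x y ↦ by
    rw [← hμ.cov, ← hfst.map_eq, integral_map (by fun_prop) (by fun_prop)]
  have hYY : ∀ x y, ∫ p, ⟪x, p.2⟫ * ⟪y, p.2⟫ ∂π = ⟪x, B y⟫ := fun x y ↦ by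
    rw [← hν.cov, ← hsnd.map_eq, integral_map (by fun_prop) (by fun_prop)]
  have hb : ∀ k, 0 ≤ b k := fun k ↦ hw.1 k ▸ hν.inner_nonneg _
  set c : ι → κ → ℝ := fun i k ↦ ∫ p, ⟪v i, p.1⟫ * ⟪w k, p.2⟫ ∂π
  -- the conditional means
  set m : κ → E → ℝ := fun k z ↦ ∑ i, c i k / a i * ⟪v i, z⟫ with hm
  have hmm : ∀ k, Measurable (m k) := fun k ↦ by fun_prop
  have hmL : ∀ k, MemLp (fun p : E × E ↦ m k p.1) 2 π := fun k ↦
    memLp_finsetSum _ fun i _ ↦ (hZ i).const_mul _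
  let φ : κ → ℝ → ℝ → ℝ := fun k r y ↦
    -(y - r) ^ 2 / (2 * (b k * s k)) + y ^ 2 / (2 * b k) - Real.log (s k) / 2
  have hφ : ∀ k r, ∫⁻ y, ENNReal.ofReal (Real.exp (φ k r y))
      ∂(gaussianReal 0 (b k).toNNReal) = 1 := by
    intro k r
    rcases (hb k).eq_or_lt with h | h
    · simp [φ, ← h, hs0 k h.symm]
    · exact lintegral_exp_gaussianReal h (hs k) r
  let f : E × E → ℝ := fun p ↦ ∑ k, φ k (m k p.1) ⟪w k, p.2⟫
  have hfm : Measurable f := by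
    simp only [f, φ]
    fun_prop
  have hexp : ∫⁻ p, ENNReal.ofReal (Real.exp (f p)) ∂(π.fst.prod π.snd) = 1 := by
    rw [hπ.1, hπ.2, lintegral_prod _ (by fun_prop)]
    have : ∀ z, ∫⁻ y, ENNReal.ofReal (Real.exp (f (z, y))) ∂ν = 1 := fun z ↦
      hν.lintegral_exp_sum hw (φ := fun k ↦ φ k (m k z)) (fun k ↦ by simp only [φ]; fun_prop)
        (fun k ↦ hφ k _)
    simp [this]
  have i1 : ∀ k, Integrable (fun p : E × E ↦
      -(⟪w k, p.2⟫ - m k p.1) ^ 2 / (2 * (b k * s k))) π := fun k ↦ by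
    simpa using! (((hY k).sub (hmL k)).integrable_sq.neg.div_const _)
  have i2 : ∀ k, Integrable (fun p : E × E ↦ ⟪w k, p.2⟫ ^ 2 / (2 * b k)) π := fun k ↦
    (hY k).integrable_sq.div_const _
  have i12 : ∀ k, Integrable (fun p : E × E ↦ -(⟪w k, p.2⟫ - m k p.1) ^ 2 / (2 * (b k * s k))
      + ⟪w k, p.2⟫ ^ 2 / (2 * b k)) π := fun k ↦ (i1 k).add (i2 k)
  have i3 : ∀ k, Integrable (fun p : E × E ↦ φ k (m k p.1) ⟪w k, p.2⟫) π := fun k ↦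
    (i12 k).sub (integrable_const _)
  have hfi : Integrable f π := integrable_finsetSum _ fun k _ ↦ i3 k
  have h := integral_le_toReal_klDiv hI hfm hfi hexp
  refine le_of_eq_of_le ?_ h
  simp only [f]
  rw [integral_finsetSum _ fun k _ ↦ i3 k]
  refine Finset.sum_congr rfl fun k _ ↦ ?_
  simp only [φ]
  rw [integral_sub (i12 k) (integrable_const _), integral_add (i1 k) (i2 k),
    integral_div, integral_div, integral_neg,
    integral_sub_regression_sq (hY k) hZ ((hYY _ _).trans (hw.1 k))
      (fun i ↦ (hZZ _ _).trans (hv.1 i)) (fun i j hij ↦ (hZZ _ _).trans (hv.2 hij)) (fun i ↦ rfl)]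
  have : ∫ p : E × E, ⟪w k, p.2⟫ ^ 2 ∂π = b k := by
    rw [← hw.1 k, ← hYY]
    exact integral_congr_ae (.of_forall fun p ↦ sq _)
  rw [this]
  simp

end gaussian

section cost

variable {E : Type*} [NormedAddCommGroup E] [InnerProductSpace ℝ E] [MeasurableSpace E]
  [FiniteDimensional ℝ E] [BorelSpace E] {μ ν : Measure E} {A B : E →ₗ[ℝ] E}
  {ι κ : Type*} [Fintype ι] [Fintype κ] {v : ι → E} {w : κ → E} {a : ι → ℝ} {b : κ → ℝ}

/-- The choice `s k = 1 - ρ(b k)²` of the free parameters. -/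
lemma sum_corr_le_mutualInfo (hμ : IsCenteredGaussian μ A) (hν : IsCenteredGaussian ν B)
    (hv : IsDiagOn A v a) (hw : IsDiagOn B w b) {lam : ℝ} (hl : 0 < lam) {π : Measure (E × E)}
    (hπ : π ∈ couplings μ ν) (hI : mutualInfo π ≠ ∞) :
    ∑ k, (b k * corr lam (b k) - gain lam (b k)
      + ∑ i, (∫ p, ⟪v i, p.1⟫ * ⟪w k, p.2⟫ ∂π) ^ 2 / a i / corr lam (b k))
      ≤ lam * (mutualInfo π).toReal := by
  have hb : ∀ k, 0 ≤ b k := fun k ↦ hw.1 k ▸ hν.inner_nonneg _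
  have h := sum_regression_le_mutualInfo hμ hν hv hw (s := fun k ↦ 1 - corr lam (b k) ^ 2)
    (fun k ↦ one_sub_corr_sq_pos hl (hb k)) (fun k hk ↦ by simp [hk, corr_zero]) hπ hI
  refine le_trans (le_of_eq ?_) (mul_le_mul_of_nonneg_left h hl.le)
  rw [Finset.mul_sum]
  refine Finset.sum_congr rfl fun k _ ↦ ?_
  have hc := corr_eq hl (b k)
  rw [← Finset.sum_div]
  generalize ∑ i, (∫ p, ⟪v i, p.1⟫ * ⟪w k, p.2⟫ ∂π) ^ 2 / a i = S
  rw [← mul_assoc 2, hc, gain]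
  rcases (hb k).eq_or_lt with h0 | h0
  · simp [← h0, corr_zero]
  · have hx := corr_pos hl h0
    field_simp
    linear_combination hc

/-- The average of the two bounds obtained by regressing each marginal on the other one. -/
lemma sum_add_sum_le_mutualInfo (hμ : IsCenteredGaussian μ A) (hν : IsCenteredGaussian ν B)
    (hv : IsDiagOn A v a) (hw : IsDiagOn B w b) {lam : ℝ} (hl : 0 < lam) {π : Measure (E × E)}
    (hπ : π ∈ couplings μ ν) (hI : mutualInfo π ≠ ∞) :
    (∑ i, (a i * corr lam (a i) - gain lam (a i))) / 2
      + (∑ k, (b k * corr lam (b k) - gain lam (b k))) / 2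
      + ∑ i, ∑ k, (∫ p, ⟪v i, p.1⟫ * ⟪w k, p.2⟫ ∂π) ^ 2
          * (1 / (a i * corr lam (b k)) + 1 / (b k * corr lam (a i))) / 2
      ≤ lam * (mutualInfo π).toReal := by
  have := hμ.isProbabilityMeasure
  have := isProbabilityMeasure_of_mem_couplings hπ
  have hle := mutualInfo_map_swap_le (π := π)
  have h1 := sum_corr_le_mutualInfo hμ hν hv hw hl hπ hI
  have h2 := sum_corr_le_mutualInfo hν hμ hw hv hl (map_swap_mem_couplings hπ)
    (ne_top_of_le_ne_top hI hle)
  have h3 := mul_le_mul_of_nonneg_left (ENNReal.toReal_mono hI hle) hl.le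
  have hsw : ∀ i k, ∫ p, ⟪w k, p.1⟫ * ⟪v i, p.2⟫ ∂(π.map Prod.swap)
      = ∫ p, ⟪v i, p.1⟫ * ⟪w k, p.2⟫ ∂π := fun i k ↦ by
    rw [integral_map (by fun_prop) (by fun_prop)]
    simp [mul_comm]
  simp_rw [hsw] at h2
  rw [Finset.sum_add_distrib] at h1 h2
  rw [Finset.sum_comm] at h1
  have h4 : ∑ i, ∑ k, (∫ p, ⟪v i, p.1⟫ * ⟪w k, p.2⟫ ∂π) ^ 2
        * (1 / (a i * corr lam (b k)) + 1 / (b k * corr lam (a i))) / 2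
      = (∑ i, ∑ k, (∫ p, ⟪v i, p.1⟫ * ⟪w k, p.2⟫ ∂π) ^ 2 / a i / corr lam (b k)) / 2
        + (∑ i, ∑ k, (∫ p, ⟪v i, p.1⟫ * ⟪w k, p.2⟫ ∂π) ^ 2 / b k / corr lam (a i)) / 2 := by
    simp_rw [Finset.sum_div, ← Finset.sum_add_distrib]
    refine Finset.sum_congr rfl fun i _ ↦ Finset.sum_congr rfl fun k _ ↦ ?_
    rw [div_div, div_div]
    ring
  rw [h4]
  linarith

/-- The elementary inequality behind the lower bound: the maximum over the cross-covariance `c`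
of a concave quadratic, followed by the arithmetic-geometric mean inequality with its defect. -/
lemma two_mul_cross_le {lam a b c q : ℝ} (hl : 0 < lam) (ha : 0 ≤ a) (hb : 0 ≤ b)
    (hc : a = 0 ∨ b = 0 → c = 0) :
    2 * (q * c) ≤ c ^ 2 * (1 / (a * corr lam b) + 1 / (b * corr lam a)) / 2
      + q ^ 2 * ((a * corr lam a + b * corr lam b) / 2
        - (√(a * corr lam a) - √(b * corr lam b)) ^ 2 / 2) := by
  have ea := Real.sq_sqrt (mul_nonneg ha (corr_nonneg hl ha))
  have eb := Real.sq_sqrt (mul_nonneg hb (corr_nonneg hl hb))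
  have hg : (a * corr lam a + b * corr lam b) / 2
      - (√(a * corr lam a) - √(b * corr lam b)) ^ 2 / 2
      = √(a * corr lam a) * √(b * corr lam b) := by
    linear_combination -(ea + eb) / 2
  rw [hg]
  rcases ha.eq_or_lt with ha0 | ha0
  · simp [hc (.inl ha0.symm)]
    positivity
  rcases hb.eq_or_lt with hb0 | hb0
  · simp [hc (.inr hb0.symm)]
    positivity
  have hx := corr_pos hl ha0
  have hy := corr_pos hl hb0
  set x := corr lam a
  set y := corr lam b
  set g := √(a * x) * √(b * y) with hgd
  have hgpos : 0 < g := by positivity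
  have hg2 : g ^ 2 = (a * y) * (b * x) := by
    rw [hgd, mul_pow, ea, eb]; ring
  have h1 : 1 / g ≤ (1 / (a * y) + 1 / (b * x)) / 2 := by
    have hay : 0 < a * y := by positivity
    have hbx : 0 < b * x := by positivity
    have h2 : g ≤ (a * y + b * x) / 2 := by
      apply le_of_sq_le_sq _ (by positivity)
      nlinarith [sq_nonneg (a * y - b * x)]
    have h3 : (1 / (a * y) + 1 / (b * x)) / 2 = (a * y + b * x) / 2 / g ^ 2 := by
      rw [hg2]; field_simp; ring
    rw [h3, div_le_div_iff₀ hgpos (by positivity)]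
    nlinarith
  have h4 : 2 * (q * c) ≤ c ^ 2 * (1 / g) + q ^ 2 * g := by
    have : c ^ 2 * (1 / g) + q ^ 2 * g - 2 * (q * c) = (c - q * g) ^ 2 / g := by
      field_simp
      ring
    have h0 : 0 ≤ (c - q * g) ^ 2 / g := by positivity
    linarith
  nlinarith [mul_le_mul_of_nonneg_left h1 (sq_nonneg c)]

lemma memLp_fst_sub_snd (hμ : IsCenteredGaussian μ A) (hν : IsCenteredGaussian ν B)
    {π : Measure (E × E)} (hπ : π ∈ couplings μ ν) :
    MemLp (fun p : E × E ↦ p.1 - p.2) 2 π :=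
  (hμ.memLp_id.comp_measurePreserving (measurePreserving_fst_of_mem_couplings hπ)).sub
    (hν.memLp_id.comp_measurePreserving (measurePreserving_snd_of_mem_couplings hπ))

lemma integral_norm_sub_sq_eq (hμ : IsCenteredGaussian μ A) (hν : IsCenteredGaussian ν B)
    {π : Measure (E × E)} (hπ : π ∈ couplings μ ν) :
    ∫ p, ‖p.1 - p.2‖ ^ 2 ∂π = ∫ z, ‖z‖ ^ 2 ∂μ + ∫ y, ‖y‖ ^ 2 ∂ν - 2 * ∫ p, ⟪p.1, p.2⟫ ∂π := by
  have := hμ.isProbabilityMeasure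
  have := isProbabilityMeasure_of_mem_couplings hπ
  have hfst := measurePreserving_fst_of_mem_couplings hπ
  have hsnd := measurePreserving_snd_of_mem_couplings hπ
  have l1 : MemLp (fun p : E × E ↦ p.1) 2 π := hμ.memLp_id.comp_measurePreserving hfst
  have l2 : MemLp (fun p : E × E ↦ p.2) 2 π := hν.memLp_id.comp_measurePreserving hsnd
  have i1 : Integrable (fun p : E × E ↦ ‖p.1‖ ^ 2) π := l1.integrable_norm_pow'
  have i2 : Integrable (fun p : E × E ↦ ‖p.2‖ ^ 2) π := l2.integrable_norm_pow'
  have i3 : Integrable (fun p : E × E ↦ 2 * ⟪p.1, p.2⟫) π := by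
    refine Integrable.const_mul (Integrable.mono (l1.norm.integrable_mul l2.norm) (by fun_prop)
      (.of_forall fun p ↦ ?_)) 2
    simpa using norm_inner_le_norm (𝕜 := ℝ) p.1 p.2
  have i13 : Integrable (fun p : E × E ↦ ‖p.1‖ ^ 2 - 2 * ⟪p.1, p.2⟫) π := i1.sub i3
  simp_rw [norm_sub_sq_real]
  rw [integral_add i13 i2, integral_sub i1 i3, integral_const_mul]
  have e1 : ∫ p : E × E, ‖p.1‖ ^ 2 ∂π = ∫ z, ‖z‖ ^ 2 ∂μ := by
    rw [← hfst.map_eq, integral_map (by fun_prop) (by fun_prop)]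
  have e2 : ∫ p : E × E, ‖p.2‖ ^ 2 ∂π = ∫ z, ‖z‖ ^ 2 ∂ν := by
    rw [← hsnd.map_eq, integral_map (by fun_prop) (by fun_prop)]
  rw [e1, e2]
  ring

/-- Lower bound for the regularized distance of two centered Gaussians. Here `q` is an orthogonal
matrix that relates the two families: `⟪z, y⟫ = ∑ q i k ⟪v i, z⟫ ⟪w k, y⟫`. The last term measures
to which extent `A` and `B` fail to agree on the two families. -/
theorem le_entropicW2sq (hμ : IsCenteredGaussian μ A) (hν : IsCenteredGaussian ν B)
    (hv : IsDiagOn A v a) (hw : IsDiagOn B w b) {lam : ℝ≥0} (hl : 0 < lam)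
    {q : ι → κ → ℝ} (hq : ∀ i, ∑ k, q i k ^ 2 = 1) (hq' : ∀ k, ∑ i, q i k ^ 2 = 1)
    (hinner : ∀ᵐ z ∂μ, ∀ y, ⟪z, y⟫ = ∑ i, ∑ k, q i k * (⟪v i, z⟫ * ⟪w k, y⟫)) :
    ENNReal.ofReal (∫ z, ‖z‖ ^ 2 ∂μ + ∫ y, ‖y‖ ^ 2 ∂ν
      - (∑ i, gain lam (a i) + ∑ k, gain lam (b k)) / 2
      + ∑ i, ∑ k, q i k ^ 2 * ((√(a i * corr lam (a i)) - √(b k * corr lam (b k))) ^ 2 / 2))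
      ≤ entropicW2sq lam μ ν := by
  have := hμ.isProbabilityMeasure
  refine le_iInf₂ fun π hπ ↦ ?_
  have := isProbabilityMeasure_of_mem_couplings hπ
  have hfst := measurePreserving_fst_of_mem_couplings hπ
  have hsnd := measurePreserving_snd_of_mem_couplings hπ
  by_cases hI : mutualInfo π = ∞
  · rw [hI, ENNReal.mul_top (by exact_mod_cast hl.ne'), add_top]
    exact le_top
  have hl' : (0 : ℝ) < lam := by exact_mod_cast hl
  have ha : ∀ i, 0 ≤ a i := fun i ↦ hv.1 i ▸ hμ.inner_nonneg _
  have hb : ∀ k, 0 ≤ b k := fun k ↦ hw.1 k ▸ hν.inner_nonneg _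
  have h := sum_add_sum_le_mutualInfo hμ hν hv hw hl' hπ hI
  set c : ι → κ → ℝ := fun i k ↦ ∫ p, ⟪v i, p.1⟫ * ⟪w k, p.2⟫ ∂π with hcd
  have hc0 : ∀ i k, a i = 0 ∨ b k = 0 → c i k = 0 := by
    intro i k h0
    refine integral_eq_zero_of_ae ?_
    rcases h0 with h0 | h0
    · filter_upwards [hfst.quasiMeasurePreserving.ae
        (hμ.ae_inner_eq_zero ((hv.1 i).trans h0))] with p hp
      simp [hp]
    · filter_upwards [hsnd.quasiMeasurePreserving.ae
        (hν.ae_inner_eq_zero ((hw.1 k).trans h0))] with p hp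
      simp [hp]
  have hZY : ∀ i k, Integrable (fun p : E × E ↦ q i k * (⟪v i, p.1⟫ * ⟪w k, p.2⟫)) π := fun i k ↦
    (((hμ.memLp_inner (v i)).comp_measurePreserving hfst).integrable_mul
      ((hν.memLp_inner (w k)).comp_measurePreserving hsnd)).const_mul _
  have hcross : ∫ p, ⟪p.1, p.2⟫ ∂π = ∑ i, ∑ k, q i k * c i k := by
    have : ∫ p, ⟪p.1, p.2⟫ ∂π = ∫ p, ∑ i, ∑ k, q i k * (⟪v i, p.1⟫ * ⟪w k, p.2⟫) ∂π := by
      refine integral_congr_ae ?_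
      filter_upwards [hfst.quasiMeasurePreserving.ae hinner] with p hp using hp p.2
    rw [this, integral_finsetSum _ fun i _ ↦ integrable_finsetSum _ fun k _ ↦ hZY i k]
    refine Finset.sum_congr rfl fun i _ ↦ ?_
    rw [integral_finsetSum _ fun k _ ↦ hZY i k]
    refine Finset.sum_congr rfl fun k _ ↦ ?_
    rw [integral_const_mul]
  have hIe : (lam : ℝ≥0∞) * mutualInfo π = ENNReal.ofReal (lam * (mutualInfo π).toReal) := by
    rw [ENNReal.ofReal_mul hl'.le, ENNReal.ofReal_toReal hI, ENNReal.ofReal_coe_nnreal]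
  rw [lintegral_enorm_sq_eq (memLp_fst_sub_snd hμ hν hπ), integral_norm_sub_sq_eq hμ hν hπ, hIe,
    hcross]
  refine (ENNReal.ofReal_le_ofReal ?_).trans ENNReal.ofReal_add_le
  have hsum := Finset.sum_le_sum fun i (_ : i ∈ Finset.univ) ↦
    Finset.sum_le_sum fun k (_ : k ∈ Finset.univ) ↦
      two_mul_cross_le (q := q i k) hl' (ha i) (hb k) (hc0 i k)
  simp_rw [Finset.sum_add_distrib, ← Finset.mul_sum, mul_sub, Finset.sum_sub_distrib] at hsum
  have hdiag : ∑ i, ∑ k, q i k ^ 2 * ((a i * corr lam (a i) + b k * corr lam (b k)) / 2)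
      = (∑ i, a i * corr lam (a i)) / 2 + (∑ k, b k * corr lam (b k)) / 2 := by
    simp_rw [add_div, mul_add, Finset.sum_add_distrib]
    congr 1
    · simp_rw [← Finset.sum_mul, hq, one_mul, Finset.sum_div]
    · rw [Finset.sum_comm]
      simp_rw [← Finset.sum_mul, hq', one_mul, Finset.sum_div]
  rw [hdiag] at hsum
  simp only [Finset.sum_sub_distrib] at h
  linarith

/-! ### Upper bound for the entropic transport cost -/

/-- The exponential of the two Schrödinger potentials and the cross term has mass one. -/
lemma lintegral_exp_corr {lam c : ℝ} (hl : 0 < lam) (hc : 0 ≤ c) (z : ℝ) :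
    ∫⁻ y, ENNReal.ofReal (Real.exp ((2 * (z * y) - corr lam c * (z ^ 2 + y ^ 2)) / lam
      - Real.log (1 - corr lam c ^ 2) / 2)) ∂(gaussianReal 0 c.toNNReal) = 1 := by
  rcases hc.eq_or_lt with h | h
  · simp [← h, corr_zero]
  have hs := one_sub_corr_sq_pos hl hc
  have hx := corr_pos hl h
  have he := corr_eq hl c
  rw [← lintegral_exp_gaussianReal h hs (corr lam c * z)]
  refine lintegral_congr fun y ↦ ?_
  congr 3
  have hlam : lam = 2 * c * (1 - corr lam c ^ 2) / corr lam c := by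
    rw [he]; field_simp
  generalize corr lam c = x at *
  rw [hlam]
  field_simp
  ring

/-- Upper bound for the regularized distance of two centered Gaussians whose covariances agree on
a family that carries all their interaction. The coupling is the Gaussian one, written through its
density with respect to the product measure: its logarithm is `lam⁻¹` times the cross term plus a
sum of one-variable functions, so that the cost plus `lam` times this logarithm decouples. -/
theorem entropicW2sq_le (hμ : IsCenteredGaussian μ A) (hν : IsCenteredGaussian ν B)
    (hv : IsDiagOn A v a) (hv' : IsDiagOn B v a) {lam : ℝ≥0} (hl : 0 < lam)
    (hinner : ∀ᵐ z ∂μ, ∀ y, ⟪z, y⟫ = ∑ i, ⟪v i, z⟫ * ⟪v i, y⟫) :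
    0 ≤ ∫ z, ‖z‖ ^ 2 ∂μ + ∫ y, ‖y‖ ^ 2 ∂ν - ∑ i, gain lam (a i) ∧
      entropicW2sq lam μ ν ≤ ENNReal.ofReal (∫ z, ‖z‖ ^ 2 ∂μ + ∫ y, ‖y‖ ^ 2 ∂ν
        - ∑ i, gain lam (a i)) := by
  have := hμ.isProbabilityMeasure
  have := hν.isProbabilityMeasure
  have hl' : (0 : ℝ) < lam := by exact_mod_cast hl
  have ha : ∀ i, 0 ≤ a i := fun i ↦ hv.1 i ▸ hμ.inner_nonneg _
  let φ : ι → ℝ → ℝ → ℝ := fun i z y ↦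
    (2 * (z * y) - corr lam (a i) * (z ^ 2 + y ^ 2)) / lam - Real.log (1 - corr lam (a i) ^ 2) / 2
  let f : E × E → ℝ := fun p ↦ ∑ i, φ i ⟪v i, p.1⟫ ⟪v i, p.2⟫
  have hfm : Measurable f := by
    simp only [f, φ]
    fun_prop
  have h1 : ∀ z, ∫⁻ y, ENNReal.ofReal (Real.exp (f (z, y))) ∂ν = 1 := fun z ↦
    hν.lintegral_exp_sum hv' (φ := fun i ↦ φ i ⟪v i, z⟫) (fun i ↦ by simp only [φ]; fun_prop)
      (fun i ↦ lintegral_exp_corr hl' (ha i) _)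
  have h2 : ∀ y, ∫⁻ z, ENNReal.ofReal (Real.exp (f (z, y))) ∂μ = 1 := fun y ↦ by
    have hsymm : ∀ i s t, φ i s t = φ i t s := fun i s t ↦ by simp only [φ]; ring
    simp only [f]
    simp_rw [hsymm _ _ ⟪_, y⟫]
    exact hμ.lintegral_exp_sum hv (φ := fun i ↦ φ i ⟪v i, y⟫)
      (fun i ↦ by simp only [φ]; fun_prop) (fun i ↦ lintegral_exp_corr hl' (ha i) _)
  set π := (μ.prod ν).withDensity fun p ↦ ENNReal.ofReal (Real.exp (f p)) with hπd
  have hπ : π ∈ couplings μ ν :=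
    ⟨fst_withDensity_prod (by fun_prop) h1, snd_withDensity_prod (by fun_prop) h2⟩
  have hfst := measurePreserving_fst_of_mem_couplings hπ
  have hsnd := measurePreserving_snd_of_mem_couplings hπ
  have hprob : IsProbabilityMeasure π := isProbabilityMeasure_of_mem_couplings hπ
  have lZ : ∀ i, MemLp (fun p : E × E ↦ ⟪v i, p.1⟫) 2 π := fun i ↦
    (hμ.memLp_inner (v i)).comp_measurePreserving hfst
  have lY : ∀ i, MemLp (fun p : E × E ↦ ⟪v i, p.2⟫) 2 π := fun i ↦
    (hν.memLp_inner (v i)).comp_measurePreserving hsnd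
  have iZY : ∀ i, Integrable (fun p : E × E ↦ ⟪v i, p.1⟫ * ⟪v i, p.2⟫) π := fun i ↦
    (lZ i).integrable_mul (lY i)
  have iZ : ∀ i, Integrable (fun p : E × E ↦ ⟪v i, p.1⟫ ^ 2) π := fun i ↦ (lZ i).integrable_sq
  have iY : ∀ i, Integrable (fun p : E × E ↦ ⟪v i, p.2⟫ ^ 2) π := fun i ↦ (lY i).integrable_sq
  have iq : ∀ i, Integrable (fun p : E × E ↦ 2 * (⟪v i, p.1⟫ * ⟪v i, p.2⟫)
      - corr lam (a i) * (⟪v i, p.1⟫ ^ 2 + ⟪v i, p.2⟫ ^ 2)) π := fun i ↦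
    ((iZY i).const_mul 2).sub (((iZ i).add (iY i)).const_mul _)
  have iZY2 : ∀ i, Integrable (fun p : E × E ↦ ⟪v i, p.1⟫ ^ 2 + ⟪v i, p.2⟫ ^ 2) π := fun i ↦
    (iZ i).add (iY i)
  have iφ : ∀ i, Integrable (fun p : E × E ↦ φ i ⟪v i, p.1⟫ ⟪v i, p.2⟫) π := fun i ↦
    ((iq i).div_const _).sub (integrable_const _)
  have hfi : Integrable f π := integrable_finsetSum _ fun i _ ↦ iφ i
  have hkl : mutualInfo π ≠ ∞ ∧ (mutualInfo π).toReal = ∫ p, f p ∂π := by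
    rw [mutualInfo, hπ.1, hπ.2]
    exact klDiv_withDensity_exp hfm hfi
  have hcross : ∫ p, ⟪p.1, p.2⟫ ∂π = ∑ i, ∫ p, ⟪v i, p.1⟫ * ⟪v i, p.2⟫ ∂π := by
    rw [← integral_finsetSum _ fun i _ ↦ iZY i]
    refine integral_congr_ae ?_
    filter_upwards [hfst.quasiMeasurePreserving.ae hinner] with p hp using hp p.2
  have mZ : ∀ i, ∫ p : E × E, ⟪v i, p.1⟫ ^ 2 ∂π = a i := fun i ↦ by
    rw [← hv.1 i, ← hμ.cov, ← hfst.map_eq, integral_map (by fun_prop) (by fun_prop)]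
    simp_rw [sq]
  have mY : ∀ i, ∫ p : E × E, ⟪v i, p.2⟫ ^ 2 ∂π = a i := fun i ↦ by
    rw [← hv'.1 i, ← hν.cov, ← hsnd.map_eq, integral_map (by fun_prop) (by fun_prop)]
    simp_rw [sq]
  have hf : lam * ∫ p, f p ∂π = 2 * ∫ p, ⟪p.1, p.2⟫ ∂π - ∑ i, gain lam (a i) := by
    simp only [f]
    rw [integral_finsetSum _ fun i _ ↦ iφ i, hcross, Finset.mul_sum, Finset.mul_sum,
      ← Finset.sum_sub_distrib]
    refine Finset.sum_congr rfl fun i _ ↦ ?_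
    simp only [φ]
    rw [integral_sub ((iq i).div_const _) (integrable_const _), integral_div,
      integral_sub ((iZY i).const_mul 2) ((iZY2 i).const_mul _), integral_const_mul,
      integral_const_mul, integral_add (iZ i) (iY i), mZ, mY, gain]
    simp only [integral_const, probReal_univ, smul_eq_mul, one_mul]
    field_simp
    ring
  have hIe : (lam : ℝ≥0∞) * mutualInfo π = ENNReal.ofReal (lam * (mutualInfo π).toReal) := by
    rw [ENNReal.ofReal_mul hl'.le, ENNReal.ofReal_toReal hkl.1, ENNReal.ofReal_coe_nnreal]
  have hcost : ∫ p, ‖p.1 - p.2‖ ^ 2 ∂π + lam * (mutualInfo π).toReal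
      = ∫ z, ‖z‖ ^ 2 ∂μ + ∫ y, ‖y‖ ^ 2 ∂ν - ∑ i, gain lam (a i) := by
    rw [hkl.2, hf, integral_norm_sub_sq_eq hμ hν hπ]
    ring
  have h0 : 0 ≤ ∫ p : E × E, ‖p.1 - p.2‖ ^ 2 ∂π := integral_nonneg fun p ↦ by positivity
  refine ⟨hcost ▸ by positivity, (iInf₂_le π hπ).trans (le_of_eq ?_)⟩
  rw [lintegral_enorm_sq_eq (memLp_fst_sub_snd hμ hν hπ), hIe,
    ← ENNReal.ofReal_add h0 (by positivity), hcost]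

/-- The independent coupling has finite cost. -/
lemma entropicW2sq_ne_top (hμ : IsCenteredGaussian μ A) (hν : IsCenteredGaussian ν B) (lam : ℝ≥0) :
    entropicW2sq lam μ ν ≠ ∞ := by
  have := hμ.isProbabilityMeasure
  have := hν.isProbabilityMeasure
  have hπ : μ.prod ν ∈ couplings μ ν := ⟨Measure.fst_prod, Measure.snd_prod⟩
  refine ne_top_of_le_ne_top ?_ (iInf₂_le _ hπ)
  rw [lintegral_enorm_sq_eq (memLp_fst_sub_snd hμ hν hπ), mutualInfo, hπ.1, hπ.2, klDiv_self]
  simp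

/-- The regularized distance of a centered Gaussian to itself. -/
lemma toReal_entropicW2sq_self (hμ : IsCenteredGaussian μ A) (hv : IsDiagOn A v a)
    {lam : ℝ≥0} (hl : 0 < lam)
    (hinner : ∀ᵐ z ∂μ, ∀ y, ⟪z, y⟫ = ∑ i, ⟪v i, z⟫ * ⟪v i, y⟫) :
    (entropicW2sq lam μ μ).toReal = 2 * ∫ z, ‖z‖ ^ 2 ∂μ - ∑ i, gain lam (a i) := by
  classical
  have hu := entropicW2sq_le hμ hμ hv hv hl hinner
  have hlow := le_entropicW2sq hμ hμ hv hv hl (q := fun i k ↦ if i = k then 1 else 0)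
    (by simp) (by simp) (by simpa using hinner)
  have hs : ∑ i, ∑ k, (if i = k then 1 else 0 : ℝ) ^ 2
      * ((√(a i * corr lam (a i)) - √(a k * corr lam (a k))) ^ 2 / 2) = 0 := by
    simp
  rw [hs] at hlow
  have h : entropicW2sq lam μ μ = ENNReal.ofReal (∫ z, ‖z‖ ^ 2 ∂μ + ∫ y, ‖y‖ ^ 2 ∂μ
      - ∑ i, gain lam (a i)) := by
    refine le_antisymm hu.2 (le_of_eq_of_le ?_ hlow)
    congr 1
    ring
  rw [h, ENNReal.toReal_ofReal hu.1]
  ring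

end cost

/-! ### Compressions and the spectrum of symmetric operators -/

section spectral

variable {E : Type*} [NormedAddCommGroup E] [InnerProductSpace ℝ E]
  {T : E →ₗ[ℝ] E} {V : Submodule ℝ E} {n d r : ℕ}

/-- The compression of a symmetric operator to a subspace has an orthonormal eigenbasis, with
eigenvalues in nonincreasing order. -/
lemma exists_isDiagOn [FiniteDimensional ℝ E] (hT : T.IsSymmetric) (hV : Module.finrank ℝ V = n) :
    ∃ (w : OrthonormalBasis (Fin n) ℝ V) (b : Fin n → ℝ),
      Antitone b ∧ IsDiagOn T (fun i ↦ (w i : E)) b := by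
  let C : V →ₗ[ℝ] V := V.orthogonalProjectionOnto.toLinearMap ∘ₗ T ∘ₗ V.subtype
  have hC : ∀ x y : V, ⟪x, C y⟫ = ⟪(x : E), T y⟫ := fun x y ↦ by
    exact Submodule.inner_orthogonalProjectionOnto_eq_of_mem_left _ _
  have hs : C.IsSymmetric := fun x y ↦ by
    rw [hC, real_inner_comm, hC, real_inner_comm]
    exact hT _ _
  refine ⟨hs.eigenvectorBasis hV, hs.eigenvalues hV, hs.eigenvalues_antitone hV, fun i ↦ ?_,
    fun i k hik ↦ ?_⟩
  · rw [← hC, hs.apply_eigenvectorBasis, inner_smul_right]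
    simp
  · change ⟪_, _⟫ = _
    rw [← hC, hs.apply_eigenvectorBasis, inner_smul_right,
      (hs.eigenvectorBasis hV).orthonormal.2 hik, mul_zero]

lemma inner_eq_sum_sum {V : Submodule ℝ E} {ι κ : Type*} [Fintype ι] [Fintype κ]
    (v : OrthonormalBasis ι ℝ V) (w : OrthonormalBasis κ ℝ V) {z : E} (hz : z ∈ V) (y : E) :
    ⟪z, y⟫ = ∑ i, ∑ k, ⟪(v i : E), w k⟫ * (⟪(v i : E), z⟫ * ⟪(w k : E), y⟫) := by
  have h1 : z = ∑ i, ⟪(v i : E), z⟫ • (v i : E) := by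
    have := congrArg (Subtype.val) (v.sum_repr' ⟨z, hz⟩)
    simpa using this.symm
  have h2 : ∀ i, (v i : E) = ∑ k, ⟪(w k : E), v i⟫ • (w k : E) := fun i ↦ by
    have := congrArg (Subtype.val) (w.sum_repr' (v i))
    simpa using this.symm
  conv_lhs => rw [h1]
  rw [sum_inner]
  refine Finset.sum_congr rfl fun i _ ↦ ?_
  have h3 : ⟪(v i : E), y⟫ = ∑ k, ⟪(w k : E), v i⟫ * ⟪(w k : E), y⟫ := by
    conv_lhs => rw [h2 i]
    rw [sum_inner]
    exact Finset.sum_congr rfl fun k _ ↦ by rw [inner_smul_left]; simp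
  rw [inner_smul_left, h3, Finset.mul_sum]
  refine Finset.sum_congr rfl fun k _ ↦ ?_
  rw [real_inner_comm (v i : E)]
  simp only [conj_trivial]
  ring

lemma inner_eq_sum {V : Submodule ℝ E} {ι : Type*} [Fintype ι]
    (v : OrthonormalBasis ι ℝ V) {z : E} (hz : z ∈ V) (y : E) :
    ⟪z, y⟫ = ∑ i, ⟪(v i : E), z⟫ * ⟪(v i : E), y⟫ := by
  classical
  rw [inner_eq_sum_sum v v hz]
  refine Finset.sum_congr rfl fun i _ ↦ ?_
  rw [Finset.sum_eq_single i]
  · have : ⟪(v i : E), v i⟫ = 1 := by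
      rw [← Submodule.coe_inner, real_inner_self_eq_norm_sq, v.norm_eq_one, one_pow]
    rw [this, one_mul]
  · intro k _ hk
    have : ⟪(v i : E), v k⟫ = 0 := by
      rw [← Submodule.coe_inner]
      exact v.orthonormal.2 hk.symm
    rw [this, zero_mul]
  · simp

lemma inner_eq_sum_basis (u : OrthonormalBasis (Fin d) ℝ E) (z y : E) :
    ⟪z, y⟫ = ∑ i, ⟪u i, z⟫ * ⟪u i, y⟫ := by
  rw [← u.sum_inner_mul_inner]
  simp_rw [real_inner_comm z]

lemma sum_inner_sq_eq_one {V : Submodule ℝ E} {κ : Type*} [Fintype κ]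
    (w : OrthonormalBasis κ ℝ V) {x : V} (hx : ‖x‖ = 1) : ∑ k, ⟪(x : E), w k⟫ ^ 2 = 1 := by
  have := w.sum_sq_norm_inner_left x
  simpa [hx] using this

lemma isDiagOn_of_apply_eq_smul {ι : Type*} {v : ι → E} {a : ι → ℝ} (hv : Orthonormal ℝ v)
    (h : ∀ i, T (v i) = a i • v i) : IsDiagOn T v a := by
  refine ⟨fun i ↦ ?_, fun i k hik ↦ ?_⟩
  · rw [h, inner_smul_right, real_inner_self_eq_norm_sq, hv.1, one_pow, mul_one]
  · simp only
    rw [h, inner_smul_right, hv.2 hik, mul_zero]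

/-- Vectors on which the compression to `V` is diagonal are eigenvectors if their images are
in `V`. -/
lemma apply_eq_smul_of_isDiagOn {ι : Type*} [Fintype ι] {v : OrthonormalBasis ι ℝ V} {a : ι → ℝ}
    (hv : IsDiagOn T (fun i ↦ (v i : E)) a) {i : ι} (hTV : T (v i) ∈ V) :
    T (v i) = a i • (v i : E) := by
  classical
  refine ext_inner_right ℝ fun y ↦ ?_
  rw [inner_eq_sum v hTV, Finset.sum_eq_single i]
  · have := hv.1 i
    simp only at this
    rw [this, inner_smul_left]
    simp
  · intro k _ hk
    have := hv.2 hk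
    simp only at this
    rw [this, zero_mul]
  · simp

/-- The span of the first `r` vectors of a basis. -/
def firstSpan (u : OrthonormalBasis (Fin d) ℝ E) (hr : r ≤ d) : Submodule ℝ E :=
  Submodule.span ℝ (Set.range fun i : Fin r ↦ u (Fin.castLE hr i))

lemma orthonormal_castLE (u : OrthonormalBasis (Fin d) ℝ E) (hr : r ≤ d) :
    Orthonormal ℝ fun i : Fin r ↦ u (Fin.castLE hr i) :=
  u.orthonormal.comp _ (Fin.castLE_injective hr)

lemma finrank_firstSpan (u : OrthonormalBasis (Fin d) ℝ E) (hr : r ≤ d) :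
    Module.finrank ℝ (firstSpan u hr) = r := by
  rw [firstSpan, finrank_span_eq_card (orthonormal_castLE u hr).linearIndependent,
    Fintype.card_fin]

lemma apply_mem_firstSpan {u : OrthonormalBasis (Fin d) ℝ E} {e : Fin d → ℝ}
    (hu : ∀ i, T (u i) = e i • u i) (hr : r ≤ d) (he : ∀ j : Fin d, r ≤ j → e j = 0) (x : E) :
    T x ∈ firstSpan u hr := by
  rw [← u.sum_repr' x, map_sum]
  refine Submodule.sum_mem _ fun j _ ↦ ?_
  rw [map_smul, hu]
  refine Submodule.smul_mem _ _ ?_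
  rcases lt_or_ge (j : ℕ) r with h | h
  · exact Submodule.smul_mem _ _ (Submodule.subset_span ⟨⟨j, h⟩, rfl⟩)
  · simp [he j h]

/-- The rank exceeds `r` exactly when an eigenvalue with index at least `r` (counting from zero)
is nonzero. -/
lemma lt_finrank_range_iff [FiniteDimensional ℝ E] {u : OrthonormalBasis (Fin d) ℝ E}
    {e : Fin d → ℝ} (hu : ∀ i, T (u i) = e i • u i) (hr : r ≤ d) (hanti : Antitone e)
    (he : ∀ i, 0 ≤ e i) :
    r < Module.finrank ℝ T.range ↔ ∃ j : Fin d, r ≤ j ∧ e j ≠ 0 := by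
  constructor
  · intro h
    by_contra! hc
    have hle : T.range ≤ firstSpan u hr := by
      rintro _ ⟨x, rfl⟩
      exact apply_mem_firstSpan hu hr hc x
    have := Submodule.finrank_mono hle
    rw [finrank_firstSpan] at this
    omega
  · rintro ⟨j, hj, hj0⟩
    have hr' : r + 1 ≤ d := by have := j.2; omega
    have hle : firstSpan u hr' ≤ T.range := by
      rw [firstSpan, Submodule.span_le]
      rintro _ ⟨i, rfl⟩
      have hij : Fin.castLE hr' i ≤ j := by
        have := i.2
        simp only [Fin.le_def, Fin.val_castLE]
        omega
      have hpos : e (Fin.castLE hr' i) ≠ 0 :=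
        ((lt_of_le_of_ne (he j) hj0.symm).trans_le (hanti hij)).ne'
      refine ⟨(e (Fin.castLE hr' i))⁻¹ • u (Fin.castLE hr' i), ?_⟩
      simp [hu, smul_smul, hpos]
    have := Submodule.finrank_mono hle
    rw [finrank_firstSpan] at this
    omega

lemma eigenvalue_nonneg {ι : Type*} [Fintype ι] {u : OrthonormalBasis ι ℝ E} {e : ι → ℝ}
    (hpos : ∀ x, 0 ≤ ⟪x, T x⟫) (hu : ∀ i, T (u i) = e i • u i) (i : ι) : 0 ≤ e i := by
  have := hpos (u i)
  rw [hu, inner_smul_right] at this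
  simpa using this

/-- The span of the first `r` eigenvectors contains the range of an operator of rank at most
`r`. -/
lemma exists_submodule_finrank_eq [FiniteDimensional ℝ E] (hT : T.IsSymmetric)
    (hpos : ∀ x, 0 ≤ ⟪x, T x⟫) (hd : Module.finrank ℝ E = d) (hr : r ≤ d)
    (hrank : Module.finrank ℝ T.range ≤ r) :
    ∃ V : Submodule ℝ E, Module.finrank ℝ V = r ∧ ∀ x, T x ∈ V := by
  have hu : ∀ i, T (hT.eigenvectorBasis hd i) = hT.eigenvalues hd i • hT.eigenvectorBasis hd i :=
    hT.apply_eigenvectorBasis hd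
  have h := (lt_finrank_range_iff hu hr (hT.eigenvalues_antitone hd)
    (eigenvalue_nonneg hpos hu)).not.1 (not_lt.2 hrank)
  push Not at h
  exact ⟨firstSpan _ hr, finrank_firstSpan _ hr, apply_mem_firstSpan hu hr h⟩

/-- Concatenation of orthonormal bases of a subspace and of its orthogonal complement. -/
lemma exists_orthonormalBasis_append [FiniteDimensional ℝ E] {V : Submodule ℝ E}
    (hd : Module.finrank ℝ E = d) (hr : r ≤ d) (w : OrthonormalBasis (Fin r) ℝ V)
    (w' : OrthonormalBasis (Fin (d - r)) ℝ Vᗮ) :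
    ∃ u : OrthonormalBasis (Fin d) ℝ E, (∀ i : Fin r, u (Fin.castLE hr i) = w i) ∧
      ∀ (j : Fin d) (hj : r ≤ j), u j = w' ⟨j - r, by have := j.2; omega⟩ := by
  let f : Fin d → E := fun j ↦ if hj : (j : ℕ) < r then w ⟨j, hj⟩
    else w' ⟨j - r, by have := j.2; omega⟩
  have hf : Orthonormal ℝ f := by
    refine ⟨fun j ↦ ?_, fun i j hij ↦ ?_⟩
    · by_cases hj : (j : ℕ) < r
      · simp only [f, hj, dite_true]
        exact w.norm_eq_one _
      · simp only [f, hj, dite_false]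
        exact w'.norm_eq_one _
    · have hne : (i : ℕ) ≠ j := fun h ↦ hij (Fin.ext h)
      by_cases hi : (i : ℕ) < r <;> by_cases hj : (j : ℕ) < r
      · simp only [f, hi, hj, dite_true]
        exact w.orthonormal.2 (by simpa using hne)
      · simp only [f, hi, hj, dite_true, dite_false]
        exact V.inner_right_of_mem_orthogonal (w _).2 (w' _).2
      · simp only [f, hi, hj, dite_true, dite_false]
        exact V.inner_left_of_mem_orthogonal (w _).2 (w' _).2
      · simp only [f, hi, hj, dite_false]
        refine w'.orthonormal.2 ?_
        simp only [ne_eq, Fin.mk.injEq]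
        omega
  have hspan : ⊤ ≤ Submodule.span ℝ (Set.range f) := by
    refine (Submodule.eq_top_of_finrank_eq ?_).ge
    rw [finrank_span_eq_card hf.linearIndependent, Fintype.card_fin, hd]
  refine ⟨OrthonormalBasis.mk hf hspan, fun i ↦ ?_, fun j hj ↦ ?_⟩
  · simp [f]
  · simp [f, hj.not_gt]

lemma sum_filter_lt_eq (hr : r ≤ d) {M : Type*} [AddCommMonoid M] (f : Fin d → M) :
    ∑ i ∈ Finset.univ.filter (fun i : Fin d ↦ (i : ℕ) < r), f i
      = ∑ i : Fin r, f (Fin.castLE hr i) := by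
  symm
  refine Finset.sum_bij (fun i _ ↦ Fin.castLE hr i) (fun i _ ↦ by simp)
    (fun i _ j _ h ↦ Fin.castLE_injective hr h) (fun j hj ↦ ?_) (fun _ _ ↦ rfl)
  simp only [Finset.mem_filter] at hj
  exact ⟨⟨j, hj.2⟩, Finset.mem_univ _, rfl⟩

/-- Weights in `[0, 1]` of total mass `r` are best placed on the `r` largest entries. -/
lemma sum_mul_le_sum_first (hr : r ≤ d) {g t : Fin d → ℝ} (hg : Antitone g) (ht0 : ∀ j, 0 ≤ t j)
    (ht1 : ∀ j, t j ≤ 1) (ht : ∑ j, t j = r) :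
    ∑ j, t j * g j ≤ ∑ i : Fin r, g (Fin.castLE hr i) := by
  rw [← sum_filter_lt_eq hr]
  rcases Nat.eq_zero_or_pos r with rfl | hpos
  · have h0 : ∀ j, t j = 0 := by
      simpa [Finset.sum_eq_zero_iff_of_nonneg fun j _ ↦ ht0 j] using ht
    simp [h0]
  -- compare with the threshold value `g (r - 1)`
  obtain ⟨c, hc1, hc2⟩ : ∃ c, (∀ j : Fin d, (j : ℕ) < r → c ≤ g j) ∧
      ∀ j : Fin d, r ≤ (j : ℕ) → g j ≤ c := by
    refine ⟨g ⟨r - 1, by omega⟩, fun j hj ↦ hg ?_, fun j hj ↦ hg ?_⟩ <;>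
      simp only [Fin.le_def] <;> omega
  have h1 : ∑ j, t j * (g j - c) ≤ ∑ j : Fin d, if (j : ℕ) < r then g j - c else 0 := by
    refine Finset.sum_le_sum fun j _ ↦ ?_
    split_ifs with h
    · nlinarith [ht1 j, hc1 j h]
    · nlinarith [ht0 j, hc2 j (not_lt.1 h)]
  rw [← Finset.sum_filter, Finset.sum_sub_distrib, Finset.sum_const] at h1
  have h2 : (Finset.univ.filter fun j : Fin d ↦ (j : ℕ) < r).card = r := by
    rw [Finset.card_eq_sum_ones, sum_filter_lt_eq hr]
    simp
  rw [h2] at h1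
  simp_rw [mul_sub, Finset.sum_sub_distrib, ← Finset.sum_mul, ht] at h1
  simpa using h1

variable {u : OrthonormalBasis (Fin d) ℝ E} {e : Fin d → ℝ} {lam : ℝ}

lemma sum_inner_sq_basis (u : OrthonormalBasis (Fin d) ℝ E) {x : E} (hx : ‖x‖ = 1) :
    ∑ j, ⟪u j, x⟫ ^ 2 = 1 := by
  have := u.sum_sq_norm_inner_right x
  simpa [hx] using this

lemma inner_apply_eq_sum (hu : ∀ i, T (u i) = e i • u i) (hT : T.IsSymmetric) (x : E) :
    ⟪x, T x⟫ = ∑ j, ⟪u j, x⟫ ^ 2 * e j := by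
  rw [← u.sum_inner_mul_inner]
  refine Finset.sum_congr rfl fun j _ ↦ ?_
  rw [← hT, hu, inner_smul_left, real_inner_comm]
  simp
  ring

/-- Jensen's inequality for `gain` in the spectral measure of a unit vector. -/
lemma gain_inner_le (hl : 0 < lam) (hu : ∀ i, T (u i) = e i • u i) (hT : T.IsSymmetric)
    (he : ∀ i, 0 ≤ e i) {x : E} (hx : ‖x‖ = 1) :
    gain lam ⟪x, T x⟫ ≤ ∑ j, ⟪u j, x⟫ ^ 2 * gain lam (e j) ∧
      (gain lam ⟪x, T x⟫ = ∑ j, ⟪u j, x⟫ ^ 2 * gain lam (e j) → T x = ⟪x, T x⟫ • x) := by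
  have hβ := inner_apply_eq_sum hu hT x
  have hβ0 : 0 ≤ ⟪x, T x⟫ := hβ ▸ Finset.sum_nonneg fun j _ ↦ mul_nonneg (sq_nonneg _) (he j)
  have hsum := sum_inner_sq_basis u hx
  set β := ⟪x, T x⟫
  -- the gap in Jensen's inequality is an average of gaps to the tangent at the mean
  have hgap : ∑ j, ⟪u j, x⟫ ^ 2 * (gain lam (e j) - (gain lam β + 2 * corr lam β * (e j - β)))
      = ∑ j, ⟪u j, x⟫ ^ 2 * gain lam (e j) - gain lam β := by
    have h1 : ∀ j, ⟪u j, x⟫ ^ 2 * (gain lam (e j) - (gain lam β + 2 * corr lam β * (e j - β)))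
        = ⟪u j, x⟫ ^ 2 * gain lam (e j) - ⟪u j, x⟫ ^ 2 * (gain lam β - 2 * corr lam β * β)
          - ⟪u j, x⟫ ^ 2 * e j * (2 * corr lam β) := fun j ↦ by ring
    simp_rw [h1, Finset.sum_sub_distrib, ← Finset.sum_mul, hsum, ← hβ]
    ring
  have hnn : ∀ j, 0 ≤ ⟪u j, x⟫ ^ 2
      * (gain lam (e j) - (gain lam β + 2 * corr lam β * (e j - β))) := fun j ↦
    mul_nonneg (sq_nonneg _) (sub_nonneg.2 (gain_tangent_le hl (he j) hβ0))
  refine ⟨?_, fun heq ↦ ?_⟩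
  · have := Finset.sum_nonneg fun j (_ : j ∈ Finset.univ) ↦ hnn j
    linarith
  · rw [← heq, sub_self, Finset.sum_eq_zero_iff_of_nonneg fun j _ ↦ hnn j] at hgap
    refine InnerProductSpace.ext_inner_left_basis u.toBasis fun j ↦ ?_
    rw [OrthonormalBasis.coe_toBasis, ← hT, hu, inner_smul_left, inner_smul_right]
    simp only [conj_trivial]
    rcases mul_eq_zero.1 (hgap j (Finset.mem_univ _)) with h | h
    · rw [pow_eq_zero_iff two_ne_zero] at h
      rw [h, mul_zero, mul_zero]
    · have : e j = β := by
        by_contra hne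
        have := gain_tangent_lt hl (he j) hβ0 hne
        linarith
      rw [this]

/-- Ky Fan's principle for `gain`: among orthonormal families of `r` vectors, the total gain of the
compressed variances is at most that of the top `r` eigenvectors, and only families of eigenvectors
reach this value. -/
lemma sum_gain_le (hl : 0 < lam) (hu : ∀ i, T (u i) = e i • u i) (hT : T.IsSymmetric)
    (hr : r ≤ d) (hanti : Antitone e) (he : ∀ i, 0 ≤ e i) {w : Fin r → E} (hw : Orthonormal ℝ w) :
    ∑ k, gain lam ⟪w k, T (w k)⟫ ≤ ∑ i : Fin r, gain lam (e (Fin.castLE hr i)) ∧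
      (∑ i : Fin r, gain lam (e (Fin.castLE hr i)) ≤ ∑ k, gain lam ⟪w k, T (w k)⟫ →
        ∀ k, T (w k) = ⟪w k, T (w k)⟫ • w k) := by
  have hJ := fun k ↦ gain_inner_le hl hu hT he (hw.1 k)
  have h1 := Finset.sum_le_sum fun k (_ : k ∈ Finset.univ) ↦ (hJ k).1
  have h2 : ∑ k, ∑ j, ⟪u j, w k⟫ ^ 2 * gain lam (e j)
      ≤ ∑ i : Fin r, gain lam (e (Fin.castLE hr i)) := by
    rw [Finset.sum_comm]
    simp_rw [← Finset.sum_mul]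
    refine sum_mul_le_sum_first hr (g := fun j ↦ gain lam (e j))
      (fun i j hij ↦ gain_le_gain hl (he _) (hanti hij))
      (fun j ↦ Finset.sum_nonneg fun k _ ↦ sq_nonneg _) (fun j ↦ ?_) ?_
    · have := hw.sum_inner_products_le (u j) (s := Finset.univ)
      simpa [real_inner_comm] using this
    · rw [Finset.sum_comm]
      simp [sum_inner_sq_basis u (hw.1 _)]
  refine ⟨h1.trans h2, fun h3 k ↦ (hJ k).2 ?_⟩
  have h4 := le_antisymm h1 (h2.trans h3)
  exact (Finset.sum_eq_sum_iff_of_le fun k _ ↦ (hJ k).1).1 h4 k (Finset.mem_univ _)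

/-- If a family of eigenvectors reaches the top total gain, then its eigenvalues dominate those of
the orthogonal eigenvectors: otherwise exchanging two vectors would increase the gain. -/
lemma eigenvalue_le_of_sum_gain_le (hl : 0 < lam) (hu : ∀ i, T (u i) = e i • u i)
    (hT : T.IsSymmetric) (hr : r ≤ d) (hanti : Antitone e) (he : ∀ i, 0 ≤ e i) {w : Fin r → E}
    (hw : Orthonormal ℝ w)
    (hge : ∑ i : Fin r, gain lam (e (Fin.castLE hr i)) ≤ ∑ k, gain lam ⟪w k, T (w k)⟫)
    {x : E} (hx : ‖x‖ = 1) (hxw : ∀ k, ⟪w k, x⟫ = 0) (k : Fin r) :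
    ⟪x, T x⟫ ≤ ⟪w k, T (w k)⟫ := by
  classical
  have hw' : Orthonormal ℝ (Function.update w k x) := by
    refine ⟨fun i ↦ ?_, fun i j hij ↦ ?_⟩
    · rcases eq_or_ne i k with rfl | h
      · simpa using hx
      · simpa [h] using hw.1 i
    · rcases eq_or_ne i k with rfl | h
      · simpa [hij.symm, real_inner_comm] using hxw j
      · rcases eq_or_ne j k with rfl | h'
        · simp [h, hxw i]
        · simpa [h, h'] using hw.2 hij
  have h := (sum_gain_le hl hu hT hr hanti he hw').1.trans hge
  rw [← Finset.add_sum_erase _ _ (Finset.mem_univ k),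
    ← Finset.add_sum_erase _ (fun k ↦ gain lam ⟪w k, T (w k)⟫) (Finset.mem_univ k)] at h
  have h2 : ∑ i ∈ Finset.univ.erase k,
        gain lam ⟪Function.update w k x i, T (Function.update w k x i)⟫
      = ∑ i ∈ Finset.univ.erase k, gain lam ⟪w i, T (w i)⟫ :=
    Finset.sum_congr rfl fun i hi ↦ by simp [Finset.ne_of_mem_erase hi]
  rw [h2, Function.update_self] at h
  have hnn : 0 ≤ ⟪w k, T (w k)⟫ := by
    rw [inner_apply_eq_sum hu hT]
    exact Finset.sum_nonneg fun j _ ↦ mul_nonneg (sq_nonneg _) (he j)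
  by_contra! hlt
  have := gain_lt_gain hl hnn hlt
  linarith

end spectral

/-! ### The Sinkhorn divergence of centered Gaussians -/

section divergence

variable {E : Type*} [NormedAddCommGroup E] [InnerProductSpace ℝ E] [MeasurableSpace E]
  [FiniteDimensional ℝ E] [BorelSpace E] {μ ν : Measure E} {A B : E →ₗ[ℝ] E} {d r : ℕ}
  {u : OrthonormalBasis (Fin d) ℝ E} {e : Fin d → ℝ} {lam : ℝ≥0}

lemma IsCenteredGaussian.ae_mem (hμ : IsCenteredGaussian μ A) {V : Submodule ℝ E}
    (hV : ∀ x, A x ∈ V) : ∀ᵐ z ∂μ, z ∈ V := by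
  let e := stdOrthonormalBasis ℝ Vᗮ
  have h : ∀ᵐ z ∂μ, ∀ i, ⟪(e i : E), z⟫ = 0 := by
    rw [ae_all_iff]
    exact fun i ↦ hμ.ae_inner_eq_zero (V.inner_left_of_mem_orthogonal (hV _) (e i).2)
  filter_upwards [h] with z hz
  rw [← V.orthogonal_orthogonal, Submodule.mem_orthogonal]
  intro y hy
  rw [inner_eq_sum e hy]
  simp [hz]

/-- Lower bound for the divergence, for `A` with range in `V`, in terms of diagonalizations of the
compressions of `A` and `B` to `V`. -/
lemma le_sinkhornDiv (hμ : IsCenteredGaussian μ A) (hν : IsCenteredGaussian ν B) (hl : 0 < lam)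
    (hu : ∀ i, B (u i) = e i • u i) {V : Submodule ℝ E} (hV : ∀ x, A x ∈ V)
    {v w : OrthonormalBasis (Fin r) ℝ V} {a b : Fin r → ℝ}
    (hv : IsDiagOn A (fun i ↦ (v i : E)) a) (hw : IsDiagOn B (fun i ↦ (w i : E)) b) :
    (∑ j, gain lam (e j) - ∑ k, gain lam (b k)) / 2
      + ∑ i, ∑ k, ⟪(v i : E), w k⟫ ^ 2
        * ((√(a i * corr lam (a i)) - √(b k * corr lam (b k))) ^ 2 / 2)
      ≤ sinkhornDiv lam μ ν := by
  have hμV := hμ.ae_mem hV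
  have h1 := toReal_entropicW2sq_self hμ hv hl (hμV.mono fun z hz y ↦ inner_eq_sum v hz y)
  have h2 := toReal_entropicW2sq_self hν (isDiagOn_of_apply_eq_smul u.orthonormal hu) hl
    (.of_forall fun z y ↦ inner_eq_sum_basis u z y)
  have h3 := le_entropicW2sq hμ hν hv hw hl (q := fun i k ↦ ⟪(v i : E), w k⟫)
    (fun i ↦ sum_inner_sq_eq_one w (v.norm_eq_one i))
    (fun k ↦ by
      simp_rw [real_inner_comm (w k : E)]
      exact sum_inner_sq_eq_one v (w.norm_eq_one k))
    (hμV.mono fun z hz y ↦ inner_eq_sum_sum v w hz y)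
  have h4 := (ENNReal.ofReal_le_iff_le_toReal (entropicW2sq_ne_top hμ hν lam)).1 h3
  rw [sinkhornDiv, h1, h2]
  linarith

/-- Truncating the spectral decomposition of `B` leaves a divergence that only depends on the
remaining eigenvalues. -/
lemma sinkhornDiv_le (hμ : IsCenteredGaussian μ A) (hν : IsCenteredGaussian ν B) (hl : 0 < lam)
    (hr : r ≤ d) (hu : ∀ i, B (u i) = e i • u i)
    (hA : ∀ i : Fin d, A (u i) = (if (i : ℕ) < r then e i else 0) • u i) :
    sinkhornDiv lam μ ν ≤
      (∑ j, gain lam (e j) - ∑ i : Fin r, gain lam (e (Fin.castLE hr i))) / 2 := by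
  have hv : IsDiagOn A (fun i : Fin r ↦ u (Fin.castLE hr i)) fun i ↦ e (Fin.castLE hr i) :=
    isDiagOn_of_apply_eq_smul (orthonormal_castLE u hr) fun i ↦ by simp [hA]
  have hv' : IsDiagOn B (fun i : Fin r ↦ u (Fin.castLE hr i)) fun i ↦ e (Fin.castLE hr i) :=
    isDiagOn_of_apply_eq_smul (orthonormal_castLE u hr) fun i ↦ hu _
  have hinner : ∀ᵐ z ∂μ, ∀ y, ⟪z, y⟫
      = ∑ i : Fin r, ⟪u (Fin.castLE hr i), z⟫ * ⟪u (Fin.castLE hr i), y⟫ := by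
    have h0 : ∀ᵐ z ∂μ, ∀ j : Fin d, r ≤ j → ⟪u j, z⟫ = 0 := by
      rw [ae_all_iff]
      intro j
      by_cases hj : r ≤ j
      · filter_upwards [hμ.ae_inner_eq_zero (x := u j) (by simp [hA, hj.not_gt])] with z hz _
        exact hz
      · exact .of_forall fun z h ↦ absurd h hj
    filter_upwards [h0] with z hz y
    rw [inner_eq_sum_basis u, ← sum_filter_lt_eq hr fun j ↦ ⟪u j, z⟫ * ⟪u j, y⟫,
      Finset.sum_filter]
    refine Finset.sum_congr rfl fun j _ ↦ ?_
    split_ifs with h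
    · rfl
    · rw [hz j (not_lt.1 h), zero_mul]
  have h1 := toReal_entropicW2sq_self hμ hv hl hinner
  have h2 := toReal_entropicW2sq_self hν (isDiagOn_of_apply_eq_smul u.orthonormal hu) hl
    (.of_forall fun z y ↦ inner_eq_sum_basis u z y)
  have h3 := entropicW2sq_le hμ hν hv hv' hl hinner
  have h4 := ENNReal.toReal_mono ENNReal.ofReal_ne_top h3.2
  rw [ENNReal.toReal_ofReal h3.1] at h4
  rw [sinkhornDiv, h1, h2]
  linarith

/-- The divergence to a Gaussian of rank at most `r` is at least half the gain of the discarded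
eigenvalues. -/
lemma le_sinkhornDiv_of_rank_le (hμ : IsCenteredGaussian μ A) (hν : IsCenteredGaussian ν B)
    (hl : 0 < lam) (hd : Module.finrank ℝ E = d) (hr : r ≤ d)
    (hA : Module.finrank ℝ A.range ≤ r) (hu : ∀ i, B (u i) = e i • u i) (hanti : Antitone e) :
    (∑ j, gain lam (e j) - ∑ i : Fin r, gain lam (e (Fin.castLE hr i))) / 2
      ≤ sinkhornDiv lam μ ν := by
  have hl' : (0 : ℝ) < lam := by exact_mod_cast hl
  obtain ⟨V, hVr, hV⟩ := exists_submodule_finrank_eq hμ.isSymmetric hμ.inner_nonneg hd hr hA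
  obtain ⟨v, a, -, hv⟩ := exists_isDiagOn hμ.isSymmetric hVr
  obtain ⟨w, b, -, hw⟩ := exists_isDiagOn hν.isSymmetric hVr
  have h1 := le_sinkhornDiv hμ hν hl hu hV hv hw
  have h2 := (sum_gain_le hl' hu hν.isSymmetric hr hanti (eigenvalue_nonneg hν.inner_nonneg hu)
    (w.orthonormal.comp_linearIsometry V.subtypeₗᵢ)).1
  have h3 : ∑ k, gain lam (b k) ≤ ∑ i : Fin r, gain lam (e (Fin.castLE hr i)) := by
    refine le_of_eq_of_le (Finset.sum_congr rfl fun k _ ↦ ?_) h2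
    rw [← hw.1 k]
    rfl
  have h4 : 0 ≤ ∑ i, ∑ k, ⟪(v i : E), w k⟫ ^ 2
      * ((√(a i * corr lam (a i)) - √(b k * corr lam (b k))) ^ 2 / 2) :=
    Finset.sum_nonneg fun i _ ↦ Finset.sum_nonneg fun k _ ↦ by positivity
  linarith

/-- Only the truncations of the spectral decomposition of `B` reach the lower bound. -/
lemma exists_eigenbasis_of_sinkhornDiv_le (hμ : IsCenteredGaussian μ A)
    (hν : IsCenteredGaussian ν B) (hl : 0 < lam) (hd : Module.finrank ℝ E = d) (hr : r ≤ d)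
    (hA : Module.finrank ℝ A.range ≤ r) (hu : ∀ i, B (u i) = e i • u i) (hanti : Antitone e)
    (h : sinkhornDiv lam μ ν
      ≤ (∑ j, gain lam (e j) - ∑ i : Fin r, gain lam (e (Fin.castLE hr i))) / 2) :
    ∃ (u' : OrthonormalBasis (Fin d) ℝ E) (e' : Fin d → ℝ), Antitone e' ∧
      (∀ i, B (u' i) = e' i • u' i) ∧
      ∀ i : Fin d, A (u' i) = (if (i : ℕ) < r then e' i else 0) • u' i := by
  have hl' : (0 : ℝ) < lam := by exact_mod_cast hl
  have hAs := hμ.isSymmetric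
  have hBs := hν.isSymmetric
  have he := eigenvalue_nonneg hν.inner_nonneg hu
  obtain ⟨V, hVr, hV⟩ := exists_submodule_finrank_eq hμ.isSymmetric hμ.inner_nonneg hd hr hA
  obtain ⟨v, a, -, hv⟩ := exists_isDiagOn hAs hVr
  obtain ⟨w, b, hbanti, hw⟩ := exists_isDiagOn hBs hVr
  have hwo : Orthonormal ℝ fun k ↦ (w k : E) := w.orthonormal.comp_linearIsometry V.subtypeₗᵢ
  have ha : ∀ i, 0 ≤ a i := fun i ↦ hv.1 i ▸ hμ.inner_nonneg _
  have hb : ∀ k, 0 ≤ b k := fun k ↦ hw.1 k ▸ hν.inner_nonneg _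
  have hbw : ∀ k, ⟪(w k : E), B (w k)⟫ = b k := hw.1
  have h1 := le_sinkhornDiv hμ hν hl hu hV hv hw
  have h2 := sum_gain_le hl' hu hBs hr hanti he hwo
  have hnn : ∀ i k, 0 ≤ ⟪(v i : E), w k⟫ ^ 2
      * ((√(a i * corr lam (a i)) - √(b k * corr lam (b k))) ^ 2 / 2) := fun i k ↦ by positivity
  have hnn' := fun i ↦ Finset.sum_nonneg fun k (_ : k ∈ Finset.univ) ↦ hnn i k
  have h0 := Finset.sum_nonneg fun i (_ : i ∈ Finset.univ) ↦ hnn' i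
  simp only [hbw] at h2
  have hge : ∑ i : Fin r, gain lam (e (Fin.castLE hr i)) ≤ ∑ k, gain lam (b k) := by linarith
  have hBw : ∀ k, B (w k) = b k • (w k : E) := h2.2 hge
  -- the defect in the lower bound vanishes, so that `A` and `B` agree on `V`
  have hdef : ∑ i, ∑ k, ⟪(v i : E), w k⟫ ^ 2
      * ((√(a i * corr lam (a i)) - √(b k * corr lam (b k))) ^ 2 / 2) = 0 := by linarith [h2.1]
  have hAw : ∀ k, A (w k) = b k • (w k : E) := by
    intro k
    refine ext_inner_right ℝ fun y ↦ ?_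
    rw [inner_eq_sum v (hV _), inner_smul_left, inner_eq_sum v (w k).2, Finset.mul_sum]
    refine Finset.sum_congr rfl fun i _ ↦ ?_
    rw [← hAs, apply_eq_smul_of_isDiagOn hv (hV _), inner_smul_left, ← mul_assoc]
    congr 1
    simp only [conj_trivial]
    have hik := (Finset.sum_eq_zero_iff_of_nonneg fun k _ ↦ hnn i k).1
      ((Finset.sum_eq_zero_iff_of_nonneg fun i _ ↦ hnn' i).1 hdef i (Finset.mem_univ _)) k
      (Finset.mem_univ _)
    rcases mul_eq_zero.1 hik with h | h
    · rw [pow_eq_zero_iff two_ne_zero] at h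
      rw [h, mul_zero, mul_zero]
    · have h5 : √(a i * corr lam (a i)) = √(b k * corr lam (b k)) := by
        have : (√(a i * corr lam (a i)) - √(b k * corr lam (b k))) ^ 2 = 0 := by linarith
        exact sub_eq_zero.1 ((pow_eq_zero_iff two_ne_zero).1 this)
      rw [Real.sqrt_inj (mul_nonneg (ha i) (corr_nonneg hl' (ha i)))
        (mul_nonneg (hb k) (corr_nonneg hl' (hb k)))] at h5
      rw [mul_corr_injOn hl' (ha i) (hb k) h5]
  -- the orthogonal complement is invariant under `B` and carries the remaining eigenvectors
  have hVc : Module.finrank ℝ Vᗮ = d - r := by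
    have := V.finrank_add_finrank_orthogonal
    omega
  obtain ⟨w', b', hbanti', hw'⟩ := exists_isDiagOn hBs hVc
  have hinv : ∀ x ∈ Vᗮ, B x ∈ Vᗮ := by
    intro x hx
    rw [Submodule.mem_orthogonal]
    intro y hy
    rw [inner_eq_sum w hy]
    refine Finset.sum_eq_zero fun k _ ↦ ?_
    rw [← hBs, hBw, inner_smul_left, V.inner_right_of_mem_orthogonal (w k).2 hx]
    simp
  have hBw' : ∀ l, B (w' l) = b' l • (w' l : E) := fun l ↦
    apply_eq_smul_of_isDiagOn hw' (hinv _ (w' l).2)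
  have hAw' : ∀ l, A (w' l) = 0 := fun l ↦ by
    refine ext_inner_right ℝ fun y ↦ ?_
    rw [hAs, V.inner_left_of_mem_orthogonal (hV y) (w' l).2, inner_zero_left]
  have hle : ∀ k l, b' l ≤ b k := fun k l ↦ by
    have h6 := eigenvalue_le_of_sum_gain_le hl' hu hBs hr hanti he hwo (by simpa only [hbw])
      (x := w' l) (w'.norm_eq_one l)
      (fun k ↦ V.inner_right_of_mem_orthogonal (w k).2 (w' l).2) k
    have h7 := hw'.1 l
    simp only at h7
    rwa [h7, hbw] at h6
  obtain ⟨u', hu1, hu2⟩ := exists_orthonormalBasis_append hd hr w w'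
  let e' : Fin d → ℝ := fun j ↦ if hj : (j : ℕ) < r then b ⟨j, hj⟩
    else b' ⟨j - r, by have := j.2; omega⟩
  have hu1' : ∀ (j : Fin d) (hj : (j : ℕ) < r), u' j = w ⟨j, hj⟩ := fun j hj ↦ hu1 ⟨j, hj⟩
  refine ⟨u', e', fun i j hij ↦ ?_, fun j ↦ ?_, fun j ↦ ?_⟩
  · have hij' : (i : ℕ) ≤ j := hij
    by_cases hj : (j : ℕ) < r
    · have hi : (i : ℕ) < r := by omega
      simp only [e', hi, hj, dite_true]
      exact hbanti hij'
    · by_cases hi : (i : ℕ) < r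
      · simp only [e', hi, hj, dite_true, dite_false]
        exact hle _ _
      · simp only [e', hi, hj, dite_false]
        refine hbanti' ?_
        simp only [Fin.mk_le_mk]
        omega
  · by_cases hj : (j : ℕ) < r
    · simp only [e', hj, dite_true]
      rw [hu1' j hj, hBw]
    · simp only [e', hj, dite_false]
      rw [hu2 j (not_lt.1 hj), hBw']
  · by_cases hj : (j : ℕ) < r
    · simp only [e', hj, dite_true, if_true]
      rw [hu1' j hj, hAw]
    · simp only [hj, if_false, zero_smul]
      rw [hu2 j (not_lt.1 hj), hAw']

end divergence

/-! ### Covariance matrices and principal components -/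

section matrix

variable {d r : ℕ} {K M : Matrix (Fin d) (Fin d) ℝ} {G : Matrix (Fin d) (Fin r) ℝ}

lemma isCenteredGaussian_multivariateGaussian (hK : K.PosSemidef) :
    IsCenteredGaussian (multivariateGaussian 0 K) (Matrix.toEuclideanLin K) := by
  have hL : MemLp (fun z ↦ z) 2 (multivariateGaussian (0 : EuclideanSpace ℝ (Fin d)) K) :=
    IsGaussian.memLp_two_id
  have hmean : ∀ x : EuclideanSpace ℝ (Fin d), ∫ z, ⟪x, z⟫ ∂(multivariateGaussian 0 K) = 0 := by
    intro x
    rw [integral_inner (hL.integrable one_le_two)]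
    simp
  refine ⟨inferInstance, hmean, fun x y ↦ ?_⟩
  have h1 := covarianceBilin_apply_eq_cov hL x y
  rw [covariance_eq_sub (hL.const_inner x) (hL.const_inner y), hmean,
    covarianceBilin_multivariateGaussian hK, zero_mul, sub_zero] at h1
  refine (h1.symm.trans ?_)
  simp [EuclideanSpace.inner_eq_star_dotProduct, Matrix.toLpLin_apply, dotProduct_comm]

lemma isCenteredGaussian_generatedLaw (G : Matrix (Fin d) (Fin r) ℝ) :
    IsCenteredGaussian (generatedLaw G) (Matrix.toEuclideanLin (G * Gᵀ)) := by
  have h := isCenteredGaussian_multivariateGaussian (d := r) Matrix.PosSemidef.one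
  have hg := h.gaussian
  have hL : generatedLaw G = (multivariateGaussian 0 1).map
      (LinearMap.toContinuousLinearMap (Matrix.toEuclideanLin G)) := rfl
  have hadj : ∀ x z, ⟪x, LinearMap.toContinuousLinearMap (Matrix.toEuclideanLin G) z⟫
      = ⟪Matrix.toEuclideanLin Gᵀ x, z⟫ := fun x z ↦ by
    rw [← Matrix.conjTranspose_eq_transpose_of_trivial,
      Matrix.toEuclideanLin_conjTranspose_eq_adjoint, LinearMap.adjoint_inner_left]
    rfl
  rw [hL]
  refine ⟨inferInstance, fun x ↦ ?_, fun x y ↦ ?_⟩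
  · rw [integral_map (by fun_prop) (by fun_prop)]
    simp_rw [hadj]
    exact h.mean _
  · rw [integral_map (by fun_prop) (by fun_prop)]
    simp_rw [hadj]
    rw [h.cov]
    rw [← Matrix.conjTranspose_eq_transpose_of_trivial,
      Matrix.toEuclideanLin_conjTranspose_eq_adjoint, LinearMap.adjoint_inner_left,
      ← Matrix.toEuclideanLin_conjTranspose_eq_adjoint]
    simp [Matrix.toLpLin_apply]

lemma IsCenteredGaussian.covarianceMatrix_eq {μ : Measure (EuclideanSpace ℝ (Fin d))}
    (hμ : IsCenteredGaussian μ (Matrix.toEuclideanLin M)) : covarianceMatrix μ = M := by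
  have := hμ.isProbabilityMeasure
  ext i j
  have hi : ∀ i : Fin d, (fun x : EuclideanSpace ℝ (Fin d) ↦ x i)
      = fun x ↦ ⟪EuclideanSpace.single i (1 : ℝ), x⟫ := fun i ↦ by
    ext x
    simp [EuclideanSpace.inner_single_left]
  rw [covarianceMatrix, Matrix.of_apply, hi, hi,
    covariance_eq_sub (hμ.memLp_inner _) (hμ.memLp_inner _), hμ.mean, zero_mul, sub_zero]
  refine (hμ.cov _ _).trans ?_
  simp [EuclideanSpace.inner_single_left, Matrix.toLpLin_apply]

lemma covarianceMatrix_generatedLaw (G : Matrix (Fin d) (Fin r) ℝ) :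
    covarianceMatrix (generatedLaw G) = G * Gᵀ :=
  (isCenteredGaussian_generatedLaw G).covarianceMatrix_eq

lemma finrank_range_toEuclideanLin (M : Matrix (Fin d) (Fin d) ℝ) :
    Module.finrank ℝ (Matrix.toEuclideanLin M).range = M.rank := by
  rw [Matrix.rank_eq_finrank_range_toLin M (EuclideanSpace.basisFun (Fin d) ℝ).toBasis
    (EuclideanSpace.basisFun (Fin d) ℝ).toBasis, Matrix.toEuclideanLin_eq_toLin_orthonormal]

lemma finrank_range_mul_transpose_le (G : Matrix (Fin d) (Fin r) ℝ) :
    Module.finrank ℝ (Matrix.toEuclideanLin (G * Gᵀ)).range ≤ r := by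
  rw [finrank_range_toEuclideanLin]
  exact ((Matrix.rank_mul_le_left _ _).trans (Matrix.rank_le_card_width _)).trans (by simp)

/-- The coordinate-free form of a truncated spectral decomposition. -/
lemma eq_sum_vecMulVec_iff (u : OrthonormalBasis (Fin d) ℝ (EuclideanSpace ℝ (Fin d)))
    (e : Fin d → ℝ) :
    M = ∑ i ∈ Finset.univ.filter (fun i : Fin d => (i : ℕ) < r),
        e i • Matrix.vecMulVec (u i).ofLp (u i).ofLp ↔
      ∀ i : Fin d, Matrix.toEuclideanLin M (u i) = (if (i : ℕ) < r then e i else 0) • u i := by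
  classical
  have key : ∀ i : Fin d, Matrix.toEuclideanLin (∑ i ∈ Finset.univ.filter
      (fun i : Fin d => (i : ℕ) < r), e i • Matrix.vecMulVec (u i).ofLp (u i).ofLp) (u i)
      = (if (i : ℕ) < r then e i else 0) • u i := by
    intro i
    have h1 : ∀ j, Matrix.toEuclideanLin (Matrix.vecMulVec (u j).ofLp (u j).ofLp) (u i)
        = ⟪u j, u i⟫ • u j := fun j ↦ by
      ext k
      simp [Matrix.toLpLin_apply, Matrix.vecMulVec_mulVec, EuclideanSpace.inner_eq_star_dotProduct,
        dotProduct_comm, mul_comm]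
    simp_rw [map_sum, map_smul, LinearMap.sum_apply, LinearMap.smul_apply, h1,
      orthonormal_iff_ite.1 u.orthonormal, Finset.sum_filter]
    rw [Finset.sum_eq_single i]
    · rw [if_pos rfl, one_smul]
      split_ifs <;> simp
    · intro j _ hj
      simp [hj]
    · simp
  constructor
  · rintro rfl
    exact key
  · intro h
    apply Matrix.toEuclideanLin.injective
    refine u.toBasis.ext fun i ↦ ?_
    rw [OrthonormalBasis.coe_toBasis, h, key]

/-- A truncated spectral decomposition with nonnegative eigenvalues is a Gram matrix. -/
lemma exists_mul_transpose_eq (hr : r ≤ d)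
    (u : OrthonormalBasis (Fin d) ℝ (EuclideanSpace ℝ (Fin d))) {e : Fin d → ℝ}
    (he : ∀ i, 0 ≤ e i) :
    ∃ G : Matrix (Fin d) (Fin r) ℝ,
      G * Gᵀ = ∑ i ∈ Finset.univ.filter (fun i : Fin d => (i : ℕ) < r),
        e i • Matrix.vecMulVec (u i).ofLp (u i).ofLp := by
  refine ⟨Matrix.of fun j i ↦ √(e (Fin.castLE hr i)) * u (Fin.castLE hr i) j, ?_⟩
  rw [sum_filter_lt_eq hr]
  ext j k
  simp only [Matrix.mul_apply, Matrix.of_apply, Matrix.transpose_apply, Matrix.sum_apply,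
    Matrix.smul_apply, Matrix.vecMulVec_apply, smul_eq_mul]
  refine Finset.sum_congr rfl fun i _ ↦ ?_
  rw [mul_mul_mul_comm, Real.mul_self_sqrt (he _)]

lemma exists_antitone_eigenbasis (hK : K.PosSemidef) :
    ∃ (u : OrthonormalBasis (Fin d) ℝ (EuclideanSpace ℝ (Fin d))) (e : Fin d → ℝ),
      Antitone e ∧ ∀ i, Matrix.toEuclideanLin K (u i) = e i • u i := by
  have hs := Matrix.isSymmetric_toEuclideanLin_iff.2 hK.isHermitian
  exact ⟨hs.eigenvectorBasis finrank_euclideanSpace_fin, hs.eigenvalues finrank_euclideanSpace_fin,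
    hs.eigenvalues_antitone _, hs.apply_eigenvectorBasis _⟩

end matrix



end SinkhornPCA

theorem mainTheorem2 (d r : ℕ) (hr : r ≤ d) (lam : ℝ≥0) (hlam : 0 < lam)
    (K : Matrix (Fin d) (Fin d) ℝ) (hK : K.PosSemidef)
    (PY : Measure (EuclideanSpace ℝ (Fin d))) (hPY : PY = multivariateGaussian 0 K) :
    -- every Sinkhorn divergence below is a combination of finite quantities
    (SinkhornPCA.entropicW2sq lam PY PY ≠ ∞ ∧
      ∀ G : Matrix (Fin d) (Fin r) ℝ,
        SinkhornPCA.entropicW2sq lam (SinkhornPCA.generatedLaw G) PY ≠ ∞ ∧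
        SinkhornPCA.entropicW2sq lam (SinkhornPCA.generatedLaw G)
          (SinkhornPCA.generatedLaw G) ≠ ∞) ∧
    -- a minimizer exists
    (∃ G : Matrix (Fin d) (Fin r) ℝ,
      IsMinOn (fun G' : Matrix (Fin d) (Fin r) ℝ =>
        SinkhornPCA.sinkhornDiv lam (SinkhornPCA.generatedLaw G') PY) Set.univ G) ∧
    -- the minimizers are exactly the generators whose output covariance is an `r`-PCA of `K`
    (∀ G : Matrix (Fin d) (Fin r) ℝ,
      IsMinOn (fun G' : Matrix (Fin d) (Fin r) ℝ =>
        SinkhornPCA.sinkhornDiv lam (SinkhornPCA.generatedLaw G') PY) Set.univ G ↔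
      SinkhornPCA.IsPCA r K (SinkhornPCA.covarianceMatrix (SinkhornPCA.generatedLaw G))) ∧
    -- every `r`-PCA of `K` is the output covariance of some generator
    (∀ M : Matrix (Fin d) (Fin d) ℝ, SinkhornPCA.IsPCA r K M →
      ∃ G : Matrix (Fin d) (Fin r) ℝ,
        SinkhornPCA.covarianceMatrix (SinkhornPCA.generatedLaw G) = M) ∧
    -- the divergence at an optimum is nonzero exactly when `K` has rank greater than `r`
    (∀ G : Matrix (Fin d) (Fin r) ℝ,
      IsMinOn (fun G' : Matrix (Fin d) (Fin r) ℝ =>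
        SinkhornPCA.sinkhornDiv lam (SinkhornPCA.generatedLaw G') PY) Set.univ G →
      (SinkhornPCA.sinkhornDiv lam (SinkhornPCA.generatedLaw G) PY ≠ 0 ↔ r < K.rank)) := by
  subst hPY
  have hν := SinkhornPCA.isCenteredGaussian_multivariateGaussian hK
  have hμ := SinkhornPCA.isCenteredGaussian_generatedLaw (d := d) (r := r)
  have hd : Module.finrank ℝ (EuclideanSpace ℝ (Fin d)) = d := finrank_euclideanSpace_fin
  have hl : (0 : ℝ) < lam := by exact_mod_cast hlam
  have hnn : ∀ {u : OrthonormalBasis (Fin d) ℝ (EuclideanSpace ℝ (Fin d))} {e : Fin d → ℝ},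
      (∀ i, Matrix.toEuclideanLin K (u i) = e i • u i) → ∀ i, 0 ≤ e i :=
    SinkhornPCA.eigenvalue_nonneg hν.inner_nonneg
  -- the same value bounds the divergence from below for all `G` and is attained at truncations,
  -- for every ordered eigenbasis: uniqueness of the eigenvalues is not needed
  have hlow : ∀ (u : OrthonormalBasis (Fin d) ℝ (EuclideanSpace ℝ (Fin d))) (e : Fin d → ℝ),
      Antitone e → (∀ i, Matrix.toEuclideanLin K (u i) = e i • u i) →
      ∀ G : Matrix (Fin d) (Fin r) ℝ,
      (∑ j, SinkhornPCA.gain lam (e j)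
        - ∑ i : Fin r, SinkhornPCA.gain lam (e (Fin.castLE hr i))) / 2
        ≤ SinkhornPCA.sinkhornDiv lam (SinkhornPCA.generatedLaw G) (multivariateGaussian 0 K) :=
    fun u e hanti hu G ↦ SinkhornPCA.le_sinkhornDiv_of_rank_le (hμ G) hν hlam hd hr
      (SinkhornPCA.finrank_range_mul_transpose_le G) hu hanti
  have hup : ∀ (u : OrthonormalBasis (Fin d) ℝ (EuclideanSpace ℝ (Fin d))) (e : Fin d → ℝ),
      (∀ i, Matrix.toEuclideanLin K (u i) = e i • u i) →
      ∀ G : Matrix (Fin d) (Fin r) ℝ,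
      G * Gᵀ = ∑ i ∈ Finset.univ.filter (fun i : Fin d => (i : ℕ) < r),
        e i • Matrix.vecMulVec (u i).ofLp (u i).ofLp →
      SinkhornPCA.sinkhornDiv lam (SinkhornPCA.generatedLaw G) (multivariateGaussian 0 K) ≤
      (∑ j, SinkhornPCA.gain lam (e j)
        - ∑ i : Fin r, SinkhornPCA.gain lam (e (Fin.castLE hr i))) / 2 :=
    fun u e hu G hG ↦ SinkhornPCA.sinkhornDiv_le (hμ G) hν hlam hr hu
      ((SinkhornPCA.eq_sum_vecMulVec_iff u e).1 hG)
  obtain ⟨u, e, hanti, hu⟩ := SinkhornPCA.exists_antitone_eigenbasis hK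
  obtain ⟨G₀, hG₀⟩ := SinkhornPCA.exists_mul_transpose_eq hr u (hnn hu)
  have hmin : ∀ G : Matrix (Fin d) (Fin r) ℝ,
      IsMinOn (fun G' : Matrix (Fin d) (Fin r) ℝ => SinkhornPCA.sinkhornDiv lam
        (SinkhornPCA.generatedLaw G') (multivariateGaussian 0 K)) Set.univ G →
      SinkhornPCA.sinkhornDiv lam (SinkhornPCA.generatedLaw G) (multivariateGaussian 0 K) ≤
      (∑ j, SinkhornPCA.gain lam (e j)
        - ∑ i : Fin r, SinkhornPCA.gain lam (e (Fin.castLE hr i))) / 2 :=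
    fun G hG ↦ (isMinOn_iff.1 hG G₀ (Set.mem_univ _)).trans (hup u e hu G₀ hG₀)
  refine ⟨⟨SinkhornPCA.entropicW2sq_ne_top hν hν lam, fun G ↦
    ⟨SinkhornPCA.entropicW2sq_ne_top (hμ G) hν lam,
      SinkhornPCA.entropicW2sq_ne_top (hμ G) (hμ G) lam⟩⟩,
    ⟨G₀, isMinOn_iff.2 fun G _ ↦ (hup u e hu G₀ hG₀).trans (hlow u e hanti hu G)⟩,
    fun G ↦ ⟨fun hG ↦ ?_, ?_⟩, ?_, fun G hG ↦ ?_⟩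
  · rw [SinkhornPCA.covarianceMatrix_generatedLaw]
    obtain ⟨u', e', hanti', hu', hA⟩ := SinkhornPCA.exists_eigenbasis_of_sinkhornDiv_le (hμ G) hν
      hlam hd hr (SinkhornPCA.finrank_range_mul_transpose_le G) hu hanti (hmin G hG)
    exact ⟨u', e', hanti', hu', (SinkhornPCA.eq_sum_vecMulVec_iff u' e').2 hA⟩
  · rw [SinkhornPCA.covarianceMatrix_generatedLaw]
    rintro ⟨u', e', hanti', hu', hG⟩
    exact isMinOn_iff.2 fun G' _ ↦ (hup u' e' hu' G hG).trans (hlow u' e' hanti' hu' G')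
  · rintro M ⟨u', e', -, hu', rfl⟩
    obtain ⟨G, hG⟩ := SinkhornPCA.exists_mul_transpose_eq hr u' (hnn hu')
    exact ⟨G, by rw [SinkhornPCA.covarianceMatrix_generatedLaw, hG]⟩
  · rw [(hmin G hG).antisymm (hlow u e hanti hu G), ← SinkhornPCA.finrank_range_toEuclideanLin,
      SinkhornPCA.lt_finrank_range_iff hu hr hanti (hnn hu),
      ← SinkhornPCA.sum_filter_lt_eq hr fun j ↦ SinkhornPCA.gain lam (e j),
      ← Finset.sum_filter_add_sum_filter_not Finset.univ fun i : Fin d ↦ (i : ℕ) < r,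
      add_sub_cancel_left, ne_eq, div_eq_zero_iff, or_iff_left two_ne_zero,
      Finset.sum_eq_zero_iff_of_nonneg fun j _ ↦ SinkhornPCA.gain_nonneg hl (hnn hu j)]
    simp [SinkhornPCA.gain_eq_zero_iff hl (hnn hu _)]
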